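/- Let $\mathbb{D}^*=\{z\in\mathbb{C}:|z|>1\}$, let $\rho_*(z)=2/(|z|^2-1)$ be the density of its hyperbolic metric, and let $0\le k<1$. Let $\mathbf{\Sigma}_k$ be the class of conformal (holomorphic, injective) maps $\varphi:\mathbb{D}^*\to\mathbb{C}$ with $\varphi(z)=z+\mathcal{O}(1/|z|)$ as $z\to\infty$ which extend to a quasiconformal homeomorphism of the plane with dilatation at most $k$, i.e. to a homeomorphism $H\in W^{1,2}_{\mathrm{loc}}(\mathbb{C})$ with $|\overline\partial H|\le k|\partial H|$ almost everywhere. For $\varphi\in\mathbf{\Sigma}_k$ let $n_\varphi=\varphi''/\varphi'$, let $\log\varphi'$ be the branch on $\mathbb{D}^*$ that tends to $0$ at infinity, put $\varphi'^{\,p}=\exp(p\log\varphi')$, and define the integral means spectrum $$\beta_\varphi(p)=\limsup_{r\to1^+}\frac{\log\int_{|z|=r}|\varphi'(z)^p|\,d\theta}{\log\frac1{r-1}},\qquad p\in\mathbb{C}.$$ A box is an annular rectangle $B=\{z: r_1<|z|<r_2,\ \theta_1<\arg z<\theta_2\}$ with $1<r_1<r_2$ and $\theta_1<\theta_2\le\theta_1+2\pi$.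 **Theorem.** Let $\varphi\in\mathbf{\Sigma}_k$ and $m,M\in\mathbb{R}$. Suppose that there are $L\in\mathbb{R}$ and $R>1$ such that $$m\ \le\ \frac{\int_B\left|\frac{2n_\varphi}{\rho_*}(z)\right|^2\rho_*(z)\,|dz|^2}{\int_B\rho_*(z)\,|dz|^2}\ \le\ M$$ for every box $B\subset\{1<|z|<R\}$ whose sides (the two radial segments and the two circular arcs) all have hyperbolic length at least $L$. Then $$m\ \le\ \liminf_{p\to0}\frac{\beta_\varphi(p)}{|p|^2/4}\ \le\ \limsup_{p\to0}\frac{\beta_\varphi(p)}{|p|^2/4}\ \le\ M,$$ where $p\to0$ through nonzero complex numbers. -/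

import Mathlib

open MeasureTheory Filter Topology Set

noncomputable section

/-- The exterior unit disk `{z : |z| > 1}`. -/
def exteriorDisk : Set ℂ := {z | 1 < ‖z‖}

/-- `F` is the weak (distributional) derivative of `H : ℂ → ℂ` in the real direction `v`. -/
def IsWeakDirDeriv (H F : ℂ → ℂ) (v : ℂ) : Prop :=
  ∀ ψ : ℂ → ℝ, ContDiff ℝ (⊤ : ℕ∞) ψ → HasCompactSupport ψ →
    ∫ z, (fderiv ℝ ψ z v) • H z = -∫ z, ψ z • F z

/-- `F` is locally square integrable on the plane. -/
def LocL2 (F : ℂ → ℂ) : Prop :=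
  ∀ K : Set ℂ, IsCompact K → MemLp F 2 (volume.restrict K)

/-- A homeomorphism `H` of the plane is quasiconformal with dilatation at most `k` (`0 ≤ k < 1`):
it lies in the Sobolev class `W^{1,2}_loc` and `|∂̄H| ≤ k |∂H|` almost everywhere, where
`∂̄H = (H_x + i H_y) / 2` and `∂H = (H_x - i H_y) / 2` are formed with the weak derivatives. -/
def IsQuasiconformal (k : ℝ) (H : ℂ ≃ₜ ℂ) : Prop :=
  ∃ Hx Hy : ℂ → ℂ, LocL2 Hx ∧ LocL2 Hy ∧
    IsWeakDirDeriv H Hx 1 ∧ IsWeakDirDeriv H Hy Complex.I ∧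
    ∀ᵐ z, ‖(Hx z + Complex.I * Hy z) / 2‖ ≤ k * ‖(Hx z - Complex.I * Hy z) / 2‖

/-- The class `Σ_k`: conformal (holomorphic and injective) maps of the exterior disk in principal
normalization `φ(z) = z + O(1/|z|)` at infinity, that extend to a quasiconformal homeomorphism of
the plane with dilatation at most `k`. Only the values of `φ` on the exterior disk matter. -/
structure IsSigma (k : ℝ) (φ : ℂ → ℂ) : Prop where
  holomorphic : DifferentiableOn ℂ φ exteriorDisk
  injective : InjOn φ exteriorDisk
  normalized : (fun z => φ z - z) =O[Bornology.cobounded ℂ] fun z => 1 / ‖z‖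
  extension : ∃ H : ℂ ≃ₜ ℂ, IsQuasiconformal k H ∧ EqOn H φ exteriorDisk

/-- The non-linearity `n_φ = φ'' / φ'`. -/
def nonlinearity (φ : ℂ → ℂ) (z : ℂ) : ℂ := deriv (deriv φ) z / deriv φ z

/-- The density `ρ_*(z) = 2 / (|z|² - 1)` of the hyperbolic metric on the exterior disk. -/
def hypDensity (z : ℂ) : ℝ := 2 / (‖z‖ ^ 2 - 1)

/-- The data of a box (annular rectangle) in the exterior disk. -/
structure AnnularBox where
  r₁ : ℝ
  r₂ : ℝ
  θ₁ : ℝ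
  θ₂ : ℝ
  one_lt_r₁ : 1 < r₁
  r₁_lt_r₂ : r₁ < r₂
  θ₁_lt_θ₂ : θ₁ < θ₂
  θ₂_le : θ₂ ≤ θ₁ + 2 * Real.pi

namespace AnnularBox

/-- The box as a set: `{z : r₁ < |z| < r₂, θ₁ < arg z < θ₂}` for a branch of the argument. -/
def toSet (B : AnnularBox) : Set ℂ :=
  {z | ∃ r ∈ Ioo B.r₁ B.r₂, ∃ θ ∈ Ioo B.θ₁ B.θ₂, z = r * Complex.exp (θ * Complex.I)}

/-- The hyperbolic length of the two radial sides. -/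
def height (B : AnnularBox) : ℝ := ∫ r in B.r₁..B.r₂, hypDensity r

/-- The hyperbolic length of the outer circular side, the shorter one of the two
(`r ρ_*(r)` decreases in `r`). -/
def width (B : AnnularBox) : ℝ := B.r₂ * hypDensity B.r₂ * (B.θ₂ - B.θ₁)

/-- The average of `f` over the box with respect to the measure `ρ_*(z) |dz|²`. -/
def average (B : AnnularBox) (f : ℂ → ℝ) : ℝ :=
  (∫ z in B.toSet, f z * hypDensity z) / ∫ z in B.toSet, hypDensity z

end AnnularBox

/-- `P` holds for all sufficiently large boxes near the unit circle: for some `L` and some `R > 1`,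
for all boxes inside `{1 < |z| < R}` all of whose sides have hyperbolic length at least `L`. -/
def ForAllLargeBoxes (P : AnnularBox → Prop) : Prop :=
  ∃ L R : ℝ, 1 < R ∧ ∀ B : AnnularBox, B.r₂ ≤ R → L ≤ B.height → L ≤ B.width → P B

/-- `g` is the branch of `log φ'` on the exterior disk that vanishes at infinity. -/
def IsLogDerivBranch (φ g : ℂ → ℂ) : Prop :=
  DifferentiableOn ℂ g exteriorDisk ∧ (∀ z ∈ exteriorDisk, Complex.exp (g z) = deriv φ z) ∧
    Tendsto g (Bornology.cobounded ℂ) (𝓝 0)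

/-- `log φ'`, the branch that vanishes at infinity. For `φ` in `Σ_k` it exists, since `φ'` has no
zeros and tends to `1` at infinity, and it is unique on the exterior disk. -/
def logDerivBranch (φ : ℂ → ℂ) : ℂ → ℂ := Classical.epsilon (IsLogDerivBranch φ)

/-- The integral mean `∫_{|z| = r} |φ'(z)^p| dθ`, where `φ'^p = exp (p log φ')`. -/
def integralMean (φ : ℂ → ℂ) (p : ℂ) (r : ℝ) : ℝ :=
  ∫ θ in (0 : ℝ)..2 * Real.pi,
    ‖Complex.exp (p * logDerivBranch φ (r * Complex.exp (θ * Complex.I)))‖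

/-- The integral means spectrum `β_φ(p)`, an upper limit in the extended reals. -/
def integralMeansSpectrum (φ : ℂ → ℂ) (p : ℂ) : EReal :=
  limsup (fun r : ℝ => ((Real.log (integralMean φ p r) / Real.log (1 / (r - 1)) : ℝ) : EReal))
    (𝓝[>] 1)

end

/-! Work in the coordinate w = log z. Put G(w) = log φ'(e^w), a holomorphic, 2πi-periodic function
on the right half-plane, and let I(s) be the integral of |exp(pG)| over one vertical period at real
part s, so that I(log r) is the integral mean at radius r. Boxes become rectangles. Near the
imaginary axis the measure ρ_*|dz|² becomes roughly dx dy / x and the integrand roughly 4x|G'|² dx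
dy, with relative errors at most e^{2b} on {x ≤ b}. The hypothesis thus compares 4∫x|G'|² with m and
M times ∫1/x on all rectangles of large hyperbolic size (`exists_rectBounds`).

Three facts carry the argument. Hardy's identity I'' = |p|²∫|G'|²|exp(pG)|
(`hasDerivAt_verticalMeanDeriv`) brings the energy into the growth of I. The upper bound M, via the
area mean value inequality, forces the Bloch bound x|G'| ≤ C near the axis
(`RectBounds.exists_bloch`). Hence on rectangles of bounded hyperbolic size |exp(pG)| varies only by
a factor e^{O(|p|)}, so the comparison survives insertion of this weight and, after tiling, holds on
strips b/l ≤ x ≤ b (`RectBounds.exists_annulus`).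

The function K = I - sI' satisfies K' = -sI'', so its increments are exactly |p|²∫x|G'|²|exp(pG)|.
The Bloch bound gives |sI'| ≤ C|p|I, hence K = (1 + O(|p|))I. Each step b → b/l therefore multiplies
K by a factor between about 1 + m(|p|²/4)log l and 1 + M(|p|²/4)log l. Iterating gives log I(s)
between about m|p|²/4 and M|p|²/4 times log(1/s) (`exists_growth_bounds`). With the starting height
T fixed, p → 0 removes all errors except e^{±2T}; then T → 0. -/

/-! ### Existence of the branch of log φ'. -/

/-- The derivative of an injective holomorphic function has no zeros. -/
theorem deriv_ne_zero_of_injOn {f : ℂ → ℂ} {U : Set ℂ} (hU : IsOpen U)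
    (hf : DifferentiableOn ℂ f U) (hinj : InjOn f U) {z₀ : ℂ} (hz₀ : z₀ ∈ U) :
    deriv f z₀ ≠ 0 := by
  intro h0
  have hUz : U ∈ 𝓝 z₀ := hU.mem_nhds hz₀
  have hfa : AnalyticAt ℂ f z₀ := hf.analyticAt hUz
  have hga : AnalyticAt ℂ (fun z => f z - f z₀) z₀ := hfa.sub analyticAt_const
  have htop : analyticOrderAt (fun z => f z - f z₀) z₀ ≠ ⊤ := by
    intro h
    rw [analyticOrderAt_eq_top] at h
    have h1 : ∀ᶠ z in 𝓝[≠] z₀, z ∈ U ∧ f z - f z₀ = 0 ∧ z ≠ z₀ := by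
      filter_upwards [nhdsWithin_le_nhds hUz, nhdsWithin_le_nhds h, self_mem_nhdsWithin]
        with z h1 h2 h3 using ⟨h1, h2, h3⟩
    obtain ⟨z, hzU, hz, hne⟩ := h1.exists
    exact hne (hinj hzU hz₀ (sub_eq_zero.1 hz))
  obtain ⟨n, hn⟩ := ENat.ne_top_iff_exists.1 htop
  obtain ⟨u, hu, hu0, hfu⟩ := (hga.analyticOrderAt_eq_natCast).1 hn.symm
  have hn0 : n ≠ 0 := by
    rintro rfl
    have := hfu.self_of_nhds
    simp at this
    exact hu0 this.symm
  -- Order one would make the derivative at `z₀` equal to `u z₀`, which is not zero.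
  have hn1 : n ≠ 1 := by
    rintro rfl
    have h1 : HasDerivAt (fun z => f z - f z₀) (u z₀) z₀ := by
      have h2 : HasDerivAt (fun z => (z - z₀) ^ 1 • u z) (1 * u z₀ + (z₀ - z₀) * deriv u z₀) z₀ := by
        have := ((hasDerivAt_id z₀).sub_const z₀).mul hu.differentiableAt.hasDerivAt
        refine this.congr_of_eventuallyEq (Eventually.of_forall fun z => by simp)
      have h3 := h2.congr_of_eventuallyEq hfu
      simpa using h3
    have h4 := (hfa.differentiableAt.hasDerivAt.sub_const (f z₀)).unique h1
    exact hu0 (by rw [← h4, h0])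
  -- an `n`-th root of `u` near `z₀`
  let v : ℂ → ℂ := fun z => Complex.exp (Complex.log (u z / u z₀) / n)
  have hv : AnalyticAt ℂ v z₀ := by
    have h1 : AnalyticAt ℂ (fun z => u z / u z₀) z₀ := hu.div analyticAt_const hu0
    have h2 : AnalyticAt ℂ (fun z => Complex.log (u z / u z₀)) z₀ :=
      h1.clog (by simp [div_self hu0])
    exact (h2.div analyticAt_const (by exact_mod_cast hn0)).cexp'
  have hv0 : v z₀ = 1 := by simp [v, div_self hu0]
  let ψ : ℂ → ℂ := fun z => (z - z₀) * v z
  have hψ : HasStrictDerivAt ψ (1 * v z₀ + (z₀ - z₀) * deriv v z₀) z₀ := by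
    have h1 : HasStrictDerivAt (fun z : ℂ => z - z₀) 1 z₀ :=
      (hasStrictDerivAt_id z₀).sub_const z₀
    exact h1.mul hv.hasStrictDerivAt
  have hψ0 : ψ z₀ = 0 := by simp [ψ]
  have hmap := hψ.map_nhds_eq (by simp [hv0])
  rw [hψ0] at hmap
  have hpow : ∀ᶠ z in 𝓝 z₀, f z - f z₀ = u z₀ * ψ z ^ n := by
    filter_upwards [hfu, hu.continuousAt.eventually_ne hu0] with z hz huz
    rw [hz]
    simp only [ψ, v, mul_pow, ← Complex.exp_nat_mul]
    rw [mul_div_cancel₀ _ (by exact_mod_cast hn0), Complex.exp_log (div_ne_zero huz hu0)]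
    simp only [smul_eq_mul]
    field_simp
  have hW : {z | z ∈ U ∧ f z - f z₀ = u z₀ * ψ z ^ n} ∈ 𝓝 z₀ := by
    filter_upwards [hUz, hpow] with z h1 h2 using ⟨h1, h2⟩
  have hV : ψ '' {z | z ∈ U ∧ f z - f z₀ = u z₀ * ψ z ^ n} ∈ 𝓝 (0 : ℂ) := by
    rw [← hmap]; exact image_mem_map hW
  obtain ⟨ε, hε, hball⟩ := Metric.mem_nhds_iff.1 hV
  -- ψ is open at `z₀`, so it takes both values ε/2 and ζε/2. Their n-th powers agree, so f takes
  -- one value at two points, against injectivity.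
  let ζ : ℂ := Complex.exp (2 * Real.pi * Complex.I / n)
  have hζ : IsPrimitiveRoot ζ n := Complex.isPrimitiveRoot_exp n hn0
  have h1 : ((ε / 2 : ℝ) : ℂ) ∈ Metric.ball (0 : ℂ) ε := by
    simp only [mem_ball_zero_iff, Complex.norm_real, Real.norm_eq_abs]
    rw [abs_of_pos (by positivity)]; linarith
  have h2 : ((ε / 2 : ℝ) : ℂ) * ζ ∈ Metric.ball (0 : ℂ) ε := by
    simp only [mem_ball_zero_iff, norm_mul, Complex.norm_real, Real.norm_eq_abs,
      hζ.norm'_eq_one hn0]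
    rw [abs_of_pos (by positivity)]; linarith
  obtain ⟨a, ⟨haU, ha⟩, haψ⟩ := hball h1
  obtain ⟨b, ⟨hbU, hb⟩, hbψ⟩ := hball h2
  have hab : f a = f b := by
    have : f a - f z₀ = f b - f z₀ := by
      rw [ha, hb, haψ, hbψ, mul_pow, hζ.pow_eq_one, mul_one]
    simpa using this
  have hab' := hinj haU hbU hab
  have h3 : ((ε / 2 : ℝ) : ℂ) * ζ = ((ε / 2 : ℝ) : ℂ) * 1 := by
    rw [mul_one, ← hbψ, ← hab', haψ]
  have h4 : ζ = 1 := mul_left_cancel₀ (by exact_mod_cast (half_pos hε).ne') h3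
  exact hζ.ne_one (by omega) h4

theorem isOpen_exteriorDisk : IsOpen exteriorDisk := isOpen_lt continuous_const continuous_norm

theorem inv_mem_exteriorDisk {w : ℂ} (hw : w ∈ Metric.ball (0 : ℂ) 1 \ {0}) :
    w⁻¹ ∈ exteriorDisk := by
  have h1 : ‖w‖ < 1 := by simpa using hw.1
  have h2 : 0 < ‖w‖ := norm_pos_iff.2 hw.2
  simp only [exteriorDisk, mem_ofPred_eq, norm_inv]
  exact (one_lt_inv₀ h2).2 h1

/-- A nowhere vanishing holomorphic function on a disk has a holomorphic logarithm. -/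
theorem exists_log_on_ball {q : ℂ → ℂ} {r : ℝ} (hr : 0 < r)
    (hq : DifferentiableOn ℂ q (Metric.ball 0 r)) (hq0 : ∀ w ∈ Metric.ball (0 : ℂ) r, q w ≠ 0)
    (hq1 : q 0 = 1) :
    ∃ l : ℂ → ℂ, DifferentiableOn ℂ l (Metric.ball 0 r) ∧ l 0 = 0 ∧
      ∀ w ∈ Metric.ball (0 : ℂ) r, Complex.exp (l w) = q w := by
  have hqd : DifferentiableOn ℂ (fun w => deriv q w / q w) (Metric.ball 0 r) :=
    (hq.deriv Metric.isOpen_ball).div hq hq0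
  obtain ⟨l, hl0, hl⟩ := hqd.isExactOn_ball.with_val_at 0 0
  refine ⟨l, fun w hw => (hl w hw).differentiableAt.differentiableWithinAt, hl0, ?_⟩
  -- As l' = q'/q, the product q·exp(-l) has zero derivative; it is constant on the ball, equal to
  -- its value 1 at the centre.
  have hder : ∀ w ∈ Metric.ball (0 : ℂ) r,
      HasDerivAt (fun w => q w * Complex.exp (-l w)) 0 w := by
    intro w hw
    have h1 := (hq.differentiableAt (Metric.isOpen_ball.mem_nhds hw)).hasDerivAt
    refine (h1.mul (hl w hw).neg.cexp).congr_deriv ?_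
    have := hq0 w hw
    field_simp
    ring
  intro w hw
  have hconst := (convex_ball (0 : ℂ) r).is_const_of_fderivWithin_eq_zero (𝕜 := ℂ)
    (f := fun w => q w * Complex.exp (-l w))
    (fun w hw => (hder w hw).differentiableAt.differentiableWithinAt)
    (fun w hw => by
      rw [fderivWithin_of_isOpen Metric.isOpen_ball hw]
      ext; simp [(hder w hw).hasFDerivAt.fderiv]) hw (Metric.mem_ball_self hr)
  simp only [hl0, hq1, neg_zero, Complex.exp_zero, mul_one] at hconst
  rw [Complex.exp_neg] at hconst
  field_simp at hconst
  exact hconst.symm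

/-- The inversion w = 1/z turns the exterior disk with infinity into the unit disk, which is simply
connected. There φ' extends to a zero-free holomorphic function with value 1 at the origin, and its
logarithm is pulled back. -/
theorem IsSigma.exists_isLogDerivBranch {k : ℝ} {φ : ℂ → ℂ} (hφ : IsSigma k φ) :
    ∃ g, IsLogDerivBranch φ g := by
  obtain ⟨C, hC⟩ := hφ.normalized.bound
  have hz0 : Tendsto (fun w : ℂ => w⁻¹) (𝓝[≠] 0) (Bornology.cobounded ℂ) :=
    tendsto_inv₀_nhdsNE_zero
  let h : ℂ → ℂ := fun w => φ w⁻¹ - w⁻¹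
  have hd : DifferentiableOn ℂ h (Metric.ball 0 1 \ {0}) := by
    have hi : DifferentiableOn ℂ (fun w : ℂ => w⁻¹) (Metric.ball 0 1 \ {0}) :=
      fun w hw => (differentiableAt_inv hw.2).differentiableWithinAt
    exact (hφ.holomorphic.comp hi fun w hw => inv_mem_exteriorDisk hw).sub hi
  have hb : h =O[𝓝[≠] 0] (fun _ => (1 : ℝ)) := by
    have h1 := hφ.normalized.comp_tendsto hz0
    refine h1.trans ?_
    refine Asymptotics.IsBigO.of_bound 1 ?_
    have : Metric.ball (0 : ℂ) 1 ∈ 𝓝[≠] (0 : ℂ) :=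
      nhdsWithin_le_nhds (Metric.ball_mem_nhds _ one_pos)
    filter_upwards [this] with w hw
    have : ‖w‖ < 1 := by simpa using hw
    simpa using this.le
  -- The normalization makes φ(1/w) - 1/w bounded near 0, which is more than the o(1/w) needed to
  -- remove the singularity.
  have hlittle : (fun w => h w - h 0) =o[𝓝[≠] 0] fun w : ℂ => (w - 0)⁻¹ := by
    have h2 : (fun w => h w - h 0) =O[𝓝[≠] 0] (fun _ => (1 : ℝ)) :=
      hb.sub (Asymptotics.isBigO_const_const _ one_ne_zero _)
    refine h2.trans_isLittleO ?_
    rw [Asymptotics.isLittleO_const_left]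
    right
    simpa [Function.comp_def] using tendsto_norm_cobounded_atTop.comp hz0
  have hupd := Complex.differentiableOn_update_limUnder_of_isLittleO
    (Metric.ball_mem_nhds (0 : ℂ) one_pos) hd hlittle
  set e : ℂ → ℂ := Function.update h 0 (limUnder (𝓝[≠] 0) h) with he
  have heq : ∀ w ∈ Metric.ball (0 : ℂ) 1 \ {0}, e w = h w := fun w hw =>
    Function.update_of_ne hw.2 _ _
  -- Differentiating e(w) = φ(1/w) - 1/w gives φ'(1/w) = 1 - w²e'(w), whose right side makes sense
  -- at w = 0 and equals 1 there.
  let q : ℂ → ℂ := fun w => 1 - w ^ 2 * deriv e w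
  have hopen : IsOpen (Metric.ball (0 : ℂ) 1 \ {0}) := Metric.isOpen_ball.sdiff isClosed_singleton
  have hφ' : ∀ w ∈ Metric.ball (0 : ℂ) 1 \ {0}, q w = deriv φ w⁻¹ := by
    intro w hw
    have hw0 : w ≠ 0 := hw.2
    have hφd : DifferentiableAt ℂ φ w⁻¹ := hφ.holomorphic.differentiableAt
      (isOpen_exteriorDisk.mem_nhds (inv_mem_exteriorDisk hw))
    have h1 : HasDerivAt h (deriv φ w⁻¹ * (-(w ^ 2)⁻¹) - (-(w ^ 2)⁻¹)) w :=
      (hφd.hasDerivAt.comp w (hasDerivAt_inv hw0)).sub (hasDerivAt_inv hw0)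
    have h2 : e =ᶠ[𝓝 w] h := by
      filter_upwards [hopen.mem_nhds hw] with x hx using heq x hx
    have h3 : deriv e w = deriv φ w⁻¹ * (-(w ^ 2)⁻¹) - (-(w ^ 2)⁻¹) := by
      rw [h2.deriv_eq, h1.deriv]
    simp only [q, h3]
    field_simp
    ring
  have hqd : DifferentiableOn ℂ q (Metric.ball 0 1) :=
    (differentiableOn_const 1).sub ((differentiableOn_id.pow 2).mul
      (hupd.deriv Metric.isOpen_ball))
  have hq0 : ∀ w ∈ Metric.ball (0 : ℂ) 1, q w ≠ 0 := by
    intro w hw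
    by_cases hw0 : w = 0
    · simp [q, hw0]
    · rw [hφ' w ⟨hw, hw0⟩]
      exact deriv_ne_zero_of_injOn isOpen_exteriorDisk hφ.holomorphic hφ.injective
        (inv_mem_exteriorDisk ⟨hw, hw0⟩)
  obtain ⟨l, hl, hl0, hexp⟩ := exists_log_on_ball one_pos hqd hq0 (by simp [q])
  have hinv : ∀ z ∈ exteriorDisk, z⁻¹ ∈ Metric.ball (0 : ℂ) 1 \ {0} := by
    intro z hz
    have hz1 : 1 < ‖z‖ := hz
    refine ⟨?_, inv_ne_zero (norm_pos_iff.1 (by linarith))⟩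
    simp only [mem_ball_zero_iff, norm_inv]
    exact inv_lt_one_of_one_lt₀ hz1
  refine ⟨fun z => l z⁻¹, ?_, ?_, ?_⟩
  · refine hl.comp (fun z hz => ?_) fun z hz => (hinv z hz).1
    exact (differentiableAt_inv (by simpa using (hinv z hz).2)).differentiableWithinAt
  · intro z hz
    rw [hexp _ (hinv z hz).1, hφ' _ (hinv z hz), inv_inv]
  · have h1 : ContinuousAt l 0 :=
      (hl.differentiableAt (Metric.ball_mem_nhds _ one_pos)).continuousAt
    have h2 := h1.tendsto.comp (tendsto_inv₀_cobounded (α := ℂ))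
    simpa [hl0, Function.comp_def] using h2

theorem IsSigma.isLogDerivBranch {k : ℝ} {φ : ℂ → ℂ} (hφ : IsSigma k φ) :
    IsLogDerivBranch φ (logDerivBranch φ) :=
  Classical.epsilon_spec hφ.exists_isLogDerivBranch

/-- The non-linearity is the derivative of `log φ'`. -/
theorem IsLogDerivBranch.nonlinearity_eq {φ g : ℂ → ℂ} (hg : IsLogDerivBranch φ g) {z : ℂ}
    (hz : z ∈ exteriorDisk) : nonlinearity φ z = deriv g z := by
  have hU := isOpen_exteriorDisk.mem_nhds hz
  have h1 : deriv φ =ᶠ[𝓝 z] fun z => Complex.exp (g z) := by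
    filter_upwards [hU] with w hw using (hg.2.1 w hw).symm
  have h2 := (hg.1.differentiableAt hU).hasDerivAt.cexp
  rw [nonlinearity, h1.deriv_eq, h2.deriv, ← hg.2.1 z hz]
  field_simp

/-! ### The right half-plane and Fubini on rectangles. -/

/-- The right half-plane. -/
def rightHalfPlane : Set ℂ := {w | 0 < w.re}

theorem isOpen_rightHalfPlane : IsOpen rightHalfPlane :=
  isOpen_lt continuous_const Complex.continuous_re

theorem add_mul_I_mem_rightHalfPlane {x : ℝ} (hx : 0 < x) (y : ℝ) :
    (x + y * Complex.I : ℂ) ∈ rightHalfPlane := by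
  simpa [rightHalfPlane] using hx

theorem reProdIm_subset_rightHalfPlane {a b : ℝ} (ha : 0 < a) (t : Set ℝ) :
    (Icc a b ×ℂ t) ⊆ rightHalfPlane := fun _ hz => ha.trans_le hz.1.1

section Fubini

variable {f : ℂ → ℝ} {a b c d : ℝ}

theorem integrableOn_prod_of_continuousOn_reProdIm (hf : ContinuousOn f (Icc a b ×ℂ Icc c d)) :
    IntegrableOn (fun p : ℝ × ℝ => f (p.1 + p.2 * Complex.I)) (Ioc a b ×ˢ Ioc c d)
      (volume.prod volume) := by
  have h1 : ContinuousOn (fun p : ℝ × ℝ => f (p.1 + p.2 * Complex.I)) (Icc a b ×ˢ Icc c d) := by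
    refine hf.comp (by fun_prop) ?_
    rintro ⟨x, y⟩ ⟨hx, hy⟩
    exact ⟨by simpa using hx, by simpa using hy⟩
  exact (h1.integrableOn_compact (isCompact_Icc.prod isCompact_Icc)).mono_set
    (prod_mono Ioc_subset_Icc_self Ioc_subset_Icc_self)

theorem setIntegral_reProdIm (s t : Set ℝ) :
    ∫ z in s ×ℂ t, f z = ∫ p in s ×ˢ t, f (p.1 + p.2 * Complex.I) ∂(volume.prod volume) := by
  rw [← Complex.volume_preserving_equiv_real_prod.symm.setIntegral_preimage_emb
    Complex.measurableEquivRealProd.symm.measurableEmbedding]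
  simp only [Complex.measurableEquivRealProd_symm_apply, Complex.mk_eq_add_mul_I]
  congr 2

theorem ae_restrict_prod_Ioo_eq : (volume.prod volume).restrict (Ioo a b ×ˢ Ioo c d) =
    ((volume : Measure ℝ).prod (volume : Measure ℝ)).restrict (Ioc a b ×ˢ Ioc c d) := by
  rw [← Measure.prod_restrict, ← Measure.prod_restrict, restrict_Ioo_eq_restrict_Ioc,
    restrict_Ioo_eq_restrict_Ioc]

theorem setIntegral_reProdIm_Ioo (hab : a ≤ b) (hcd : c ≤ d)
    (hf : ContinuousOn f (Icc a b ×ℂ Icc c d)) :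
    ∫ z in Ioo a b ×ℂ Ioo c d, f z = ∫ y in c..d, ∫ x in a..b, f (x + y * Complex.I) := by
  rw [setIntegral_reProdIm, ae_restrict_prod_Ioo_eq, ← Measure.prod_restrict,
    integral_prod_symm]
  · simp only [intervalIntegral.integral_of_le hab, intervalIntegral.integral_of_le hcd]
  · rw [Measure.prod_restrict]; exact integrableOn_prod_of_continuousOn_reProdIm hf

theorem intervalIntegral_swap_of_continuousOn (hab : a ≤ b) (hcd : c ≤ d)
    (hf : ContinuousOn f (Icc a b ×ℂ Icc c d)) :
    ∫ y in c..d, ∫ x in a..b, f (x + y * Complex.I) =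
      ∫ x in a..b, ∫ y in c..d, f (x + y * Complex.I) := by
  simp only [intervalIntegral.integral_of_le hab, intervalIntegral.integral_of_le hcd]
  have h := integrableOn_prod_of_continuousOn_reProdIm hf
  rw [IntegrableOn, ← Measure.prod_restrict] at h
  rw [← integral_prod_symm _ h, ← integral_prod _ h]

theorem intervalIntegrable_integral_left (hab : a ≤ b) (hcd : c ≤ d)
    (hf : ContinuousOn f (Icc a b ×ℂ Icc c d)) :
    IntervalIntegrable (fun y => ∫ x in a..b, f (x + y * Complex.I)) volume c d := by
  simp only [intervalIntegral.integral_of_le hab]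
  have h := integrableOn_prod_of_continuousOn_reProdIm hf
  rw [IntegrableOn, ← Measure.prod_restrict] at h
  exact (intervalIntegrable_iff_integrableOn_Ioc_of_le hcd).2 h.integral_prod_right

theorem intervalIntegrable_integral_right (hab : a ≤ b) (hcd : c ≤ d)
    (hf : ContinuousOn f (Icc a b ×ℂ Icc c d)) :
    IntervalIntegrable (fun x => ∫ y in c..d, f (x + y * Complex.I)) volume a b := by
  simp only [intervalIntegral.integral_of_le hcd]
  have h := integrableOn_prod_of_continuousOn_reProdIm hf
  rw [IntegrableOn, ← Measure.prod_restrict] at h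
  exact (intervalIntegrable_iff_integrableOn_Ioc_of_le hab).2 h.integral_prod_left

/-- Monotonicity of integrals over rectangles. -/
theorem integral_reProdIm_mono {g : ℂ → ℝ} (hab : a ≤ b) (hcd : c ≤ d)
    (hf : ContinuousOn f (Icc a b ×ℂ Icc c d)) (hg : ContinuousOn g (Icc a b ×ℂ Icc c d))
    (hfg : ∀ z ∈ Icc a b ×ℂ Icc c d, f z ≤ g z) :
    ∫ y in c..d, ∫ x in a..b, f (x + y * Complex.I) ≤
      ∫ y in c..d, ∫ x in a..b, g (x + y * Complex.I) := by
  rw [← setIntegral_reProdIm_Ioo hab hcd hf, ← setIntegral_reProdIm_Ioo hab hcd hg,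
    setIntegral_reProdIm, setIntegral_reProdIm]
  have hsub : Ioo a b ×ˢ Ioo c d ⊆ Ioc a b ×ˢ Ioc c d :=
    prod_mono Ioo_subset_Ioc_self Ioo_subset_Ioc_self
  refine setIntegral_mono_on ((integrableOn_prod_of_continuousOn_reProdIm hf).mono_set hsub)
    ((integrableOn_prod_of_continuousOn_reProdIm hg).mono_set hsub)
    (measurableSet_Ioo.prod measurableSet_Ioo) ?_
  rintro ⟨x, y⟩ ⟨hx, hy⟩
  exact hfg _ ⟨by simpa using Ioo_subset_Icc_self hx, by simpa using Ioo_subset_Icc_self hy⟩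

end Fubini

/-! ### Vertical means and Hardy's identity. -/

theorem continuous_add_mul_I_right (s : ℝ) : Continuous fun θ : ℝ => (s + θ * Complex.I : ℂ) := by
  fun_prop

theorem ContinuousOn.comp_vertical {f : ℂ → ℝ} (hf : ContinuousOn f rightHalfPlane) {s : ℝ}
    (hs : 0 < s) : Continuous fun θ : ℝ => f (s + θ * Complex.I) :=
  hf.comp_continuous (continuous_add_mul_I_right s) fun θ => add_mul_I_mem_rightHalfPlane hs θ

/-- Differentiation of vertical integrals under the integral sign. -/
theorem hasDerivAt_integral_vertical {f f' : ℂ → ℝ} {a b : ℝ}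
    (hf : ContinuousOn f rightHalfPlane) (hf' : ContinuousOn f' rightHalfPlane)
    (hd : ∀ s θ : ℝ, 0 < s →
      HasDerivAt (fun x : ℝ => f (x + θ * Complex.I)) (f' (s + θ * Complex.I)) s)
    {s : ℝ} (hs : 0 < s) :
    HasDerivAt (fun x : ℝ => ∫ θ in a..b, f (x + θ * Complex.I))
      (∫ θ in a..b, f' (s + θ * Complex.I)) s := by
  -- The derivative is bounded on a compact rectangle around the segment, and this constant
  -- dominates.
  have hK : IsCompact (Icc (s / 2) (2 * s) ×ℂ uIcc a b) := isCompact_Icc.reProdIm isCompact_uIcc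
  obtain ⟨C, hC⟩ := hK.exists_bound_of_continuousOn
    (hf'.mono (reProdIm_subset_rightHalfPlane (half_pos hs) _))
  refine (intervalIntegral.hasDerivAt_integral_of_dominated_loc_of_deriv_le (bound := fun _ => C)
    (F := fun (x θ : ℝ) => f (x + θ * Complex.I)) (F' := fun (x θ : ℝ) => f' (x + θ * Complex.I))
    (s := Icc (s / 2) (2 * s)) (Icc_mem_nhds (by linarith) (by linarith)) ?_ ?_ ?_ ?_ ?_ ?_).2
  · filter_upwards [lt_mem_nhds hs] with x hx
    exact (hf.comp_vertical hx).aestronglyMeasurable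
  · exact (hf.comp_vertical hs).intervalIntegrable _ _
  · exact (hf'.comp_vertical hs).aestronglyMeasurable
  · refine Eventually.of_forall fun θ hθ x hx => hC _ ⟨by simpa using hx, ?_⟩
    simpa using uIoc_subset_uIcc hθ
  · exact intervalIntegrable_const
  · exact Eventually.of_forall fun θ _ x hx => hd x θ (by linarith [hx.1])

/-- The vertical mean `∫ |exp (p G)|` over the segment `[s, s + 2πi]`. -/
noncomputable def verticalMean (G : ℂ → ℂ) (p : ℂ) (s : ℝ) : ℝ :=
  ∫ θ in (0 : ℝ)..2 * Real.pi, ‖Complex.exp (p * G (s + θ * Complex.I))‖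

/-- The derivative of `verticalMean`. -/
noncomputable def verticalMeanDeriv (G : ℂ → ℂ) (p : ℂ) (s : ℝ) : ℝ :=
  ∫ θ in (0 : ℝ)..2 * Real.pi, (p * deriv G (s + θ * Complex.I)).re *
    ‖Complex.exp (p * G (s + θ * Complex.I))‖

/-- The weighted energy `∫ |G'|² |exp (p G)|` over the segment `[s, s + 2πi]`. -/
noncomputable def verticalEnergy (G : ℂ → ℂ) (p : ℂ) (s : ℝ) : ℝ :=
  ∫ θ in (0 : ℝ)..2 * Real.pi, ‖deriv G (s + θ * Complex.I)‖ ^ 2 *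
    ‖Complex.exp (p * G (s + θ * Complex.I))‖

section Calculus

variable {G : ℂ → ℂ} {p : ℂ}

theorem hasDerivAt_re_horizontal {h : ℂ → ℂ} {h' : ℂ} {s θ : ℝ}
    (hh : HasDerivAt h h' (s + θ * Complex.I)) :
    HasDerivAt (fun x : ℝ => (h (x + θ * Complex.I)).re) h'.re s := by
  have h1 : HasDerivAt (fun x : ℝ => (x + θ * Complex.I : ℂ)) 1 s :=
    Complex.ofRealCLM.hasDerivAt.add_const _
  have h2 : HasDerivAt (fun x : ℝ => h (x + θ * Complex.I)) h' s :=
    (hh.comp s h1).congr_deriv (mul_one _)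
  exact Complex.reCLM.hasFDerivAt.comp_hasDerivAt s h2

theorem hasDerivAt_vertical {h : ℂ → ℂ} {h' : ℂ} {s θ : ℝ}
    (hh : HasDerivAt h h' (s + θ * Complex.I)) :
    HasDerivAt (fun y : ℝ => h (s + y * Complex.I)) (h' * Complex.I) θ := by
  have h1 : HasDerivAt (fun y : ℝ => (s + y * Complex.I : ℂ)) (1 * Complex.I) θ :=
    (Complex.ofRealCLM.hasDerivAt.mul_const _).const_add _
  exact (hh.comp θ h1).congr_deriv (by rw [one_mul])

theorem hasDerivAt_re_vertical {h : ℂ → ℂ} {h' : ℂ} {s θ : ℝ}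
    (hh : HasDerivAt h h' (s + θ * Complex.I)) :
    HasDerivAt (fun y : ℝ => (h (s + y * Complex.I)).re) (-h'.im) θ := by
  exact (Complex.reCLM.hasFDerivAt.comp_hasDerivAt θ (hasDerivAt_vertical hh)).congr_deriv
    (by simp)

theorem hasDerivAt_im_vertical {h : ℂ → ℂ} {h' : ℂ} {s θ : ℝ}
    (hh : HasDerivAt h h' (s + θ * Complex.I)) :
    HasDerivAt (fun y : ℝ => (h (s + y * Complex.I)).im) h'.re θ := by
  exact (Complex.imCLM.hasFDerivAt.comp_hasDerivAt θ (hasDerivAt_vertical hh)).congr_deriv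
    (by simp)

variable (hG : DifferentiableOn ℂ G rightHalfPlane)
include hG

theorem continuousOn_norm_exp_mul :
    ContinuousOn (fun w => ‖Complex.exp (p * G w)‖) rightHalfPlane :=
  (Complex.continuous_exp.comp_continuousOn (continuousOn_const.mul hG.continuousOn)).norm

theorem continuousOn_deriv_rightHalfPlane : ContinuousOn (deriv G) rightHalfPlane :=
  (hG.deriv isOpen_rightHalfPlane).continuousOn

theorem hasDerivAt_of_rightHalfPlane {w : ℂ} (hw : w ∈ rightHalfPlane) :
    HasDerivAt G (deriv G w) w :=
  (hG.differentiableAt (isOpen_rightHalfPlane.mem_nhds hw)).hasDerivAt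

theorem hasDerivAt_deriv_of_rightHalfPlane {w : ℂ} (hw : w ∈ rightHalfPlane) :
    HasDerivAt (deriv G) (deriv (deriv G) w) w :=
  hasDerivAt_of_rightHalfPlane (hG.deriv isOpen_rightHalfPlane) hw

theorem hasDerivAt_norm_exp_horizontal {s θ : ℝ} (hs : 0 < s) :
    HasDerivAt (fun x : ℝ => ‖Complex.exp (p * G (x + θ * Complex.I))‖)
      ((p * deriv G (s + θ * Complex.I)).re * ‖Complex.exp (p * G (s + θ * Complex.I))‖) s := by
  have hw := add_mul_I_mem_rightHalfPlane hs θ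
  have h := (hasDerivAt_re_horizontal ((hasDerivAt_of_rightHalfPlane hG hw).const_mul p)).exp
  simp only [Complex.norm_exp]
  exact h.congr_deriv (mul_comm _ _)

theorem hasDerivAt_verticalMean {s : ℝ} (hs : 0 < s) :
    HasDerivAt (verticalMean G p) (verticalMeanDeriv G p s) s := by
  refine hasDerivAt_integral_vertical (f := fun w => ‖Complex.exp (p * G w)‖)
    (f' := fun w => (p * deriv G w).re * ‖Complex.exp (p * G w)‖)
    (continuousOn_norm_exp_mul hG) ?_ (fun s θ hs => hasDerivAt_norm_exp_horizontal hG hs) hs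
  exact (Complex.continuous_re.comp_continuousOn
    (continuousOn_const.mul (continuousOn_deriv_rightHalfPlane hG))).mul
    (continuousOn_norm_exp_mul hG)

/-- Hardy's identity. Differentiating twice in x leaves a term with G''; subtracting an exact
θ-derivative, whose integral over a period vanishes, cancels it and leaves |pG'|²|exp(pG)|. -/
theorem hasDerivAt_verticalMeanDeriv
    (hper : ∀ w ∈ rightHalfPlane, G (w + 2 * Real.pi * Complex.I) = G w) {s : ℝ} (hs : 0 < s) :
    HasDerivAt (verticalMeanDeriv G p) (‖p‖ ^ 2 * verticalEnergy G p s) s := by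
  have hc0 := continuousOn_norm_exp_mul (p := p) hG
  have hc1 := continuousOn_deriv_rightHalfPlane hG
  have hc2 := continuousOn_deriv_rightHalfPlane (hG.deriv isOpen_rightHalfPlane)
  have hre1 : ContinuousOn (fun w => (p * deriv G w).re) rightHalfPlane :=
    Complex.continuous_re.comp_continuousOn (continuousOn_const.mul hc1)
  have him1 : ContinuousOn (fun w => (p * deriv G w).im) rightHalfPlane :=
    Complex.continuous_im.comp_continuousOn (continuousOn_const.mul hc1)
  have hre2 : ContinuousOn (fun w => (p * deriv (deriv G) w).re) rightHalfPlane :=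
    Complex.continuous_re.comp_continuousOn (continuousOn_const.mul hc2)
  let f₁ : ℂ → ℝ := fun w => ((p * deriv (deriv G) w).re + (p * deriv G w).re ^ 2) *
    ‖Complex.exp (p * G w)‖
  -- This is the θ-derivative of Im(pG')|exp(pG)|, and `f₁ - f₂` is |pG'|²|exp(pG)|.
  let f₂ : ℂ → ℝ := fun w => ((p * deriv (deriv G) w).re - (p * deriv G w).im ^ 2) *
    ‖Complex.exp (p * G w)‖
  have hf₁ : ContinuousOn f₁ rightHalfPlane := (hre2.add (hre1.pow 2)).mul hc0
  have hf₂ : ContinuousOn f₂ rightHalfPlane := (hre2.sub (him1.pow 2)).mul hc0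
  have h1 : HasDerivAt (verticalMeanDeriv G p)
      (∫ θ in (0 : ℝ)..2 * Real.pi, f₁ (s + θ * Complex.I)) s := by
    refine hasDerivAt_integral_vertical
      (f := fun w => (p * deriv G w).re * ‖Complex.exp (p * G w)‖) (hre1.mul hc0) hf₁ ?_ hs
    intro s θ hs
    have hw := add_mul_I_mem_rightHalfPlane hs θ
    have h := (hasDerivAt_re_horizontal
      ((hasDerivAt_deriv_of_rightHalfPlane hG hw).const_mul p)).mul
      (hasDerivAt_norm_exp_horizontal (p := p) (θ := θ) hG hs)
    exact h.congr_deriv (by simp only [f₁]; ring)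
  have h2 : ∫ θ in (0 : ℝ)..2 * Real.pi, f₂ (s + θ * Complex.I) = 0 := by
    have hd : ∀ θ : ℝ, HasDerivAt (fun y : ℝ => (p * deriv G (s + y * Complex.I)).im *
        ‖Complex.exp (p * G (s + y * Complex.I))‖) (f₂ (s + θ * Complex.I)) θ := by
      intro θ
      have hw := add_mul_I_mem_rightHalfPlane hs θ
      have ha := (hasDerivAt_re_vertical ((hasDerivAt_of_rightHalfPlane hG hw).const_mul p)).exp
      have hb := (hasDerivAt_im_vertical
        ((hasDerivAt_deriv_of_rightHalfPlane hG hw).const_mul p)).mul ha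
      simp only [f₂, Complex.norm_exp]
      exact hb.congr_deriv (by ring)
    rw [intervalIntegral.integral_eq_sub_of_hasDerivAt (fun θ _ => hd θ)
      ((hf₂.comp_vertical hs).intervalIntegrable _ _)]
    have hw : (s + (0 : ℝ) * Complex.I : ℂ) ∈ rightHalfPlane := add_mul_I_mem_rightHalfPlane hs 0
    have hperd : ∀ w ∈ rightHalfPlane, deriv G (w + 2 * Real.pi * Complex.I) = deriv G w := by
      intro w hw
      rw [← deriv_comp_add_const]
      refine EventuallyEq.deriv_eq ?_
      filter_upwards [isOpen_rightHalfPlane.mem_nhds hw] with z hz using hper z hz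
    have e : (s + (2 * Real.pi : ℝ) * Complex.I : ℂ) =
        (s + (0 : ℝ) * Complex.I) + 2 * Real.pi * Complex.I := by push_cast; ring
    rw [e, hperd _ hw, hper _ hw, sub_self]
  refine h1.congr_deriv ?_
  have h3 := sub_zero (∫ θ in (0 : ℝ)..2 * Real.pi, f₁ (s + θ * Complex.I))
  rw [← h3, ← congrArg (HSub.hSub _) h2, ← intervalIntegral.integral_sub
    ((hf₁.comp_vertical hs).intervalIntegrable _ _)
    ((hf₂.comp_vertical hs).intervalIntegrable _ _), verticalEnergy,
    ← intervalIntegral.integral_const_mul]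
  congr 1
  ext θ
  simp only [f₁, f₂]
  rw [← mul_assoc, ← mul_pow, ← norm_mul, ← Complex.normSq_eq_norm_sq, Complex.normSq_apply]
  ring

theorem verticalMean_pos {s : ℝ} (hs : 0 < s) : 0 < verticalMean G p s := by
  refine intervalIntegral.intervalIntegral_pos_of_pos
    (((continuousOn_norm_exp_mul hG).comp_vertical hs).intervalIntegrable _ _)
    (fun θ => norm_pos_iff.2 (Complex.exp_ne_zero _)) (by positivity)

theorem continuousOn_energy_density :
    ContinuousOn (fun w => ‖deriv G w‖ ^ 2 * ‖Complex.exp (p * G w)‖) rightHalfPlane :=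
  ((continuousOn_deriv_rightHalfPlane hG).norm.pow 2).mul (continuousOn_norm_exp_mul hG)

omit hG in
theorem verticalEnergy_nonneg (s : ℝ) : 0 ≤ verticalEnergy G p s :=
  intervalIntegral.integral_nonneg (by positivity) fun θ _ => by positivity

end Calculus

/-! ### Boxes as rectangles in logarithmic coordinates. -/

/-- The iterated integral of `f` over the rectangle `[a, b] × [c, d]`. -/
noncomputable def rectIntegral (f : ℂ → ℝ) (a b c d : ℝ) : ℝ :=
  ∫ y in c..d, ∫ x in a..b, f (x + y * Complex.I)

theorem rectIntegral_eq_setIntegral {f : ℂ → ℝ} {a b c d : ℝ} (hab : a ≤ b) (hcd : c ≤ d)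
    (hf : ContinuousOn f (Icc a b ×ℂ Icc c d)) :
    rectIntegral f a b c d = ∫ z in Ioo a b ×ℂ Ioo c d, f z :=
  (setIntegral_reProdIm_Ioo hab hcd hf).symm

theorem rectIntegral_const_mul (r : ℝ) (f : ℂ → ℝ) (a b c d : ℝ) :
    rectIntegral (fun z => r * f z) a b c d = r * rectIntegral f a b c d := by
  simp [rectIntegral, intervalIntegral.integral_const_mul]

theorem rectIntegral_mono {f g : ℂ → ℝ} {a b c d : ℝ} (ha : 0 < a) (hab : a ≤ b) (hcd : c ≤ d)
    (hf : ContinuousOn f rightHalfPlane) (hg : ContinuousOn g rightHalfPlane)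
    (hfg : ∀ z ∈ Icc a b ×ℂ Icc c d, f z ≤ g z) :
    rectIntegral f a b c d ≤ rectIntegral g a b c d :=
  integral_reProdIm_mono hab hcd (hf.mono (reProdIm_subset_rightHalfPlane ha _))
    (hg.mono (reProdIm_subset_rightHalfPlane ha _)) hfg

theorem rectIntegral_nonneg {f : ℂ → ℝ} {a b c d : ℝ} (hab : a ≤ b) (hcd : c ≤ d)
    (hf : ∀ z, 0 < z.re → 0 ≤ f z) (ha : 0 < a) : 0 ≤ rectIntegral f a b c d :=
  intervalIntegral.integral_nonneg hcd fun y _ => intervalIntegral.integral_nonneg hab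
    fun x hx => hf _ (by simpa using ha.trans_le hx.1)

theorem continuousOn_one_div_re : ContinuousOn (fun z : ℂ => 1 / z.re) rightHalfPlane :=
  continuousOn_const.div Complex.continuous_re.continuousOn fun _ hz => (ne_of_gt hz)

theorem rectIntegral_one_div_re {a b : ℝ} (ha : 0 < a) (hb : 0 < b) (c d : ℝ) :
    rectIntegral (fun z => 1 / z.re) a b c d = (d - c) * Real.log (b / a) := by
  simp [rectIntegral, integral_inv_of_pos ha hb]

namespace AnnularBox

/-- The box which is the image of a rectangle under the exponential map. -/
noncomputable def ofLog (a b c d : ℝ) (ha : 0 < a) (hab : a < b) (hcd : c < d)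
    (hd : d ≤ c + 2 * Real.pi) : AnnularBox where
  r₁ := Real.exp a
  r₂ := Real.exp b
  θ₁ := c
  θ₂ := d
  one_lt_r₁ := Real.one_lt_exp_iff.2 ha
  r₁_lt_r₂ := Real.exp_lt_exp.2 hab
  θ₁_lt_θ₂ := hcd
  θ₂_le := hd

variable {a b c d : ℝ} (ha : 0 < a) (hab : a < b) (hcd : c < d) (hd : d ≤ c + 2 * Real.pi)

theorem ofLog_toSet : (ofLog a b c d ha hab hcd hd).toSet =
    Complex.exp '' (Ioo a b ×ℂ Ioo c d) := by
  ext z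
  constructor
  · rintro ⟨r, ⟨hr1, hr2⟩, θ, hθ, rfl⟩
    have hr : 0 < r := (Real.exp_pos a).trans hr1
    refine ⟨(Real.log r : ℝ) + θ * Complex.I, ⟨?_, ?_⟩, ?_⟩
    · simpa using ⟨(Real.lt_log_iff_exp_lt hr).2 hr1, (Real.log_lt_iff_lt_exp hr).2 hr2⟩
    · have hθ' : c < θ ∧ θ < d := hθ
      simpa using hθ'
    · rw [Complex.exp_add, ← Complex.ofReal_exp, Real.exp_log hr]
  · rintro ⟨w, ⟨h1, h2⟩, rfl⟩
    refine ⟨Real.exp w.re, ⟨Real.exp_lt_exp.2 h1.1, Real.exp_lt_exp.2 h1.2⟩, w.im, h2, ?_⟩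
    rw [Complex.ofReal_exp, ← Complex.exp_add, Complex.re_add_im]

theorem injOn_exp_reProdIm (hd : d ≤ c + 2 * Real.pi) :
    InjOn Complex.exp (Ioo a b ×ℂ Ioo c d) := by
  rintro z ⟨-, hz⟩ w ⟨-, hw⟩ h
  obtain ⟨n, hn⟩ := Complex.exp_eq_exp_iff_exists_int.1 h
  have him : z.im = w.im + n * (2 * Real.pi) := by simpa using congrArg Complex.im hn
  have hz1 : c < z.im ∧ z.im < d := hz
  have hw1 : c < w.im ∧ w.im < d := hw
  have hpi := Real.two_pi_pos
  have h1 : (n : ℝ) < 1 := by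
    by_contra! hcon
    nlinarith
  have h2 : (-1 : ℝ) < n := by
    by_contra! hcon
    nlinarith
  have h3 : n < 1 := by exact_mod_cast h1
  have h4 : -1 < n := by exact_mod_cast h2
  obtain rfl : n = 0 := by omega
  simpa using hn

/-- Change of variables z = e^w: the real Jacobian of a holomorphic map is the squared modulus of
its derivative, here e^{2 Re w}. -/
theorem setIntegral_ofLog (h : ℂ → ℝ) : ∫ z in (ofLog a b c d ha hab hcd hd).toSet, h z =
    ∫ w in Ioo a b ×ℂ Ioo c d, Real.exp w.re ^ 2 * h (Complex.exp w) := by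
  rw [ofLog_toSet]
  have hmeas : MeasurableSet (Ioo a b ×ℂ Ioo c d) :=
    (isOpen_Ioo.reProdIm isOpen_Ioo).measurableSet
  rw [integral_image_eq_integral_abs_det_fderiv_smul volume hmeas
    (fun w _ => ((Complex.hasDerivAt_exp w).hasFDerivAt.restrictScalars ℝ).hasFDerivWithinAt)
    (injOn_exp_reProdIm hd)]
  refine setIntegral_congr_fun hmeas fun w _ => ?_
  simp [ContinuousLinearMap.det, LinearMap.det_restrictScalars, Algebra.norm_complex_eq,
    Complex.normSq_eq_norm_sq, Complex.norm_exp]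

theorem hypDensity_exp (w : ℂ) :
    hypDensity (Complex.exp w) = 2 / (Real.exp (2 * w.re) - 1) := by
  rw [hypDensity, Complex.norm_exp, ← Real.exp_nat_mul]
  norm_num

end AnnularBox

theorem two_mul_le_exp_sub_one (x : ℝ) : 2 * x ≤ Real.exp (2 * x) - 1 := by
  linarith [Real.add_one_le_exp (2 * x)]

theorem exp_sub_one_le_mul_exp (x : ℝ) : Real.exp x - 1 ≤ x * Real.exp x := by
  have h1 := Real.add_one_le_exp (-x)
  have h2 : Real.exp (-x) * Real.exp x = 1 := by rw [← Real.exp_add]; simp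
  nlinarith [Real.exp_pos x]

theorem continuousOn_div_exp_sub_one :
    ContinuousOn (fun z : ℂ => 2 * Real.exp (2 * z.re) / (Real.exp (2 * z.re) - 1))
      rightHalfPlane := by
  refine ContinuousOn.div (by fun_prop) (by fun_prop) fun z hz => ?_
  have h1 : 0 < z.re := hz
  linarith [two_mul_le_exp_sub_one z.re]

/-- The logarithm of `φ'` in logarithmic coordinates. -/
theorem differentiableOn_comp_exp {g : ℂ → ℂ} (hg : DifferentiableOn ℂ g exteriorDisk) :
    DifferentiableOn ℂ (fun w => g (Complex.exp w)) rightHalfPlane :=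
  hg.comp Complex.differentiable_exp.differentiableOn fun w hw => by
    have h1 : 0 < w.re := hw
    simpa [exteriorDisk, Complex.norm_exp] using h1

theorem deriv_comp_exp {g : ℂ → ℂ} (hg : DifferentiableOn ℂ g exteriorDisk) {w : ℂ}
    (hw : w ∈ rightHalfPlane) :
    deriv (fun w => g (Complex.exp w)) w = deriv g (Complex.exp w) * Complex.exp w := by
  have h1 : Complex.exp w ∈ exteriorDisk := by
    have h1 : 0 < w.re := hw
    simpa [exteriorDisk, Complex.norm_exp] using h1
  exact ((hg.differentiableAt (isOpen_exteriorDisk.mem_nhds h1)).hasDerivAt.comp w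
    (Complex.hasDerivAt_exp w)).deriv

section Average

variable {φ g : ℂ → ℂ} {a b c d : ℝ}

/-- The average over a box in logarithmic coordinates. -/
theorem average_ofLog (hg : IsLogDerivBranch φ g) (ha : 0 < a) (hab : a < b) (hcd : c < d)
    (hd : d ≤ c + 2 * Real.pi) :
    (AnnularBox.ofLog a b c d ha hab hcd hd).average
        (fun z => ‖2 * nonlinearity φ z / (hypDensity z : ℂ)‖ ^ 2) =
      rectIntegral (fun w => 2 * (Real.exp (2 * w.re) - 1) *
          ‖deriv (fun w => g (Complex.exp w)) w‖ ^ 2) a b c d /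
        rectIntegral (fun w => 2 * Real.exp (2 * w.re) / (Real.exp (2 * w.re) - 1)) a b c d := by
  have hsub : Icc a b ×ℂ Icc c d ⊆ rightHalfPlane := reProdIm_subset_rightHalfPlane ha _
  have hsub' : Ioo a b ×ℂ Ioo c d ⊆ rightHalfPlane := fun z hz => ha.trans hz.1.1
  have hmeas : MeasurableSet (Ioo a b ×ℂ Ioo c d) :=
    (isOpen_Ioo.reProdIm isOpen_Ioo).measurableSet
  have hc1 := continuousOn_deriv_rightHalfPlane (differentiableOn_comp_exp hg.1)
  rw [AnnularBox.average, AnnularBox.setIntegral_ofLog, AnnularBox.setIntegral_ofLog,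
    rectIntegral_eq_setIntegral hab.le hcd.le, rectIntegral_eq_setIntegral hab.le hcd.le]
  · congr 1
    · refine setIntegral_congr_fun hmeas fun w hw => ?_
      have hw0 : 0 < w.re := hsub' hw
      have h1 : Complex.exp w ∈ exteriorDisk := by
        simpa [exteriorDisk, Complex.norm_exp] using hw0
      have h2 := two_mul_le_exp_sub_one w.re
      have h3 : Real.exp (2 * w.re) - 1 ≠ 0 := by linarith
      rw [deriv_comp_exp hg.1 (hsub' hw), hg.nonlinearity_eq h1, AnnularBox.hypDensity_exp,
        norm_div, norm_mul, norm_mul, Complex.norm_exp, Complex.norm_real, Real.norm_eq_abs,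
        abs_of_nonneg (by apply div_nonneg <;> linarith)]
      simp only [Complex.norm_ofNat]
      field_simp
    · refine setIntegral_congr_fun hmeas fun w hw => ?_
      rw [AnnularBox.hypDensity_exp, ← Real.exp_nat_mul]
      push_cast
      ring
  · exact continuousOn_div_exp_sub_one.mono hsub
  · exact ((by fun_prop : ContinuousOn (fun w : ℂ => 2 * (Real.exp (2 * w.re) - 1))
      rightHalfPlane).mul (hc1.norm.pow 2)).mono hsub

theorem continuousOn_re_mul_norm_deriv_sq {G : ℂ → ℂ} (hG : DifferentiableOn ℂ G rightHalfPlane) :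
    ContinuousOn (fun w => w.re * ‖deriv G w‖ ^ 2) rightHalfPlane :=
  Complex.continuous_re.continuousOn.mul ((continuousOn_deriv_rightHalfPlane hG).norm.pow 2)

/-- From 2x ≤ e^{2x} - 1 ≤ 2x e^{2x}, the exact weights 2(e^{2x} - 1) and 2e^{2x}/(e^{2x} - 1) lie
between 4x and 1/x respectively and e^{2b} times these. The energy is nonnegative, so m may be
replaced by `max m 0`; this keeps the later multiplications monotone. Likewise a single box already
gives M ≥ 0. -/
theorem rect_bounds_of_average (hg : IsLogDerivBranch φ g) (ha : 0 < a) (hab : a < b)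
    (hcd : c < d) (hd : d ≤ c + 2 * Real.pi) {m M : ℝ}
    (hm : m ≤ (AnnularBox.ofLog a b c d ha hab hcd hd).average
        (fun z => ‖2 * nonlinearity φ z / (hypDensity z : ℂ)‖ ^ 2))
    (hM : (AnnularBox.ofLog a b c d ha hab hcd hd).average
        (fun z => ‖2 * nonlinearity φ z / (hypDensity z : ℂ)‖ ^ 2) ≤ M) :
    max m 0 * ((d - c) * Real.log (b / a)) ≤ Real.exp (2 * b) *
        (4 * rectIntegral (fun w => w.re * ‖deriv (fun w => g (Complex.exp w)) w‖ ^ 2) a b c d) ∧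
      4 * rectIntegral (fun w => w.re * ‖deriv (fun w => g (Complex.exp w)) w‖ ^ 2) a b c d ≤
        Real.exp (2 * b) * (M * ((d - c) * Real.log (b / a))) ∧ 0 ≤ M := by
  rw [average_ofLog hg] at hm hM
  set G : ℂ → ℂ := fun w => g (Complex.exp w) with hGdef
  have hG : DifferentiableOn ℂ G rightHalfPlane := differentiableOn_comp_exp hg.1
  have hc1 := continuousOn_deriv_rightHalfPlane hG
  have hc2 : ContinuousOn (fun w => 2 * (Real.exp (2 * w.re) - 1) * ‖deriv G w‖ ^ 2)
      rightHalfPlane := (by fun_prop : ContinuousOn (fun w : ℂ => 2 * (Real.exp (2 * w.re) - 1))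
      rightHalfPlane).mul (hc1.norm.pow 2)
  rw [← rectIntegral_one_div_re ha (ha.trans hab), ← rectIntegral_const_mul 4]
  have hcE := continuousOn_re_mul_norm_deriv_sq hG
  have hpos : ∀ z ∈ Icc a b ×ℂ Icc c d, 0 < z.re := fun z hz => ha.trans_le hz.1.1
  have hexp : ∀ z ∈ Icc a b ×ℂ Icc c d, Real.exp (2 * z.re) ≤ Real.exp (2 * b) :=
    fun z hz => Real.exp_le_exp.2 (by linarith [hz.1.2])
  have hA : 0 < rectIntegral (fun z => 1 / z.re) a b c d := by
    rw [rectIntegral_one_div_re ha (ha.trans hab)]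
    exact mul_pos (by linarith) (Real.log_pos ((one_lt_div ha).2 hab))
  have hσ1 : rectIntegral (fun z => 1 / z.re) a b c d ≤
      rectIntegral (fun w => 2 * Real.exp (2 * w.re) / (Real.exp (2 * w.re) - 1)) a b c d := by
    refine rectIntegral_mono ha hab.le hcd.le continuousOn_one_div_re
      continuousOn_div_exp_sub_one fun z hz => ?_
    have h0 := hpos z hz
    have h1 := two_mul_le_exp_sub_one z.re
    rw [div_le_div_iff₀ h0 (by linarith)]
    have h2 := exp_sub_one_le_mul_exp (2 * z.re)
    linarith
  have hσ2 : rectIntegral (fun w => 2 * Real.exp (2 * w.re) / (Real.exp (2 * w.re) - 1)) a b c d ≤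
      Real.exp (2 * b) * rectIntegral (fun z => 1 / z.re) a b c d := by
    rw [← rectIntegral_const_mul]
    refine rectIntegral_mono ha hab.le hcd.le continuousOn_div_exp_sub_one
      (continuousOn_const.mul continuousOn_one_div_re) fun z hz => ?_
    have h0 := hpos z hz
    have h1 := two_mul_le_exp_sub_one z.re
    rw [mul_one_div, div_le_div_iff₀ (by linarith) h0]
    have h2 := hexp z hz
    nlinarith [Real.exp_pos (2 * b)]
  have hq1 : rectIntegral (fun z => 4 * (z.re * ‖deriv G z‖ ^ 2)) a b c d ≤
      rectIntegral (fun w => 2 * (Real.exp (2 * w.re) - 1) * ‖deriv G w‖ ^ 2) a b c d := by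
    refine rectIntegral_mono ha hab.le hcd.le (continuousOn_const.mul hcE) hc2 fun z hz => ?_
    have h1 := two_mul_le_exp_sub_one z.re
    nlinarith [sq_nonneg ‖deriv G z‖]
  have hq2 : rectIntegral (fun w => 2 * (Real.exp (2 * w.re) - 1) * ‖deriv G w‖ ^ 2) a b c d ≤
      Real.exp (2 * b) * rectIntegral (fun z => 4 * (z.re * ‖deriv G z‖ ^ 2)) a b c d := by
    rw [← rectIntegral_const_mul]
    refine rectIntegral_mono ha hab.le hcd.le hc2
      (continuousOn_const.mul (continuousOn_const.mul hcE)) fun z hz => ?_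
    have h0 := hpos z hz
    have h1 := exp_sub_one_le_mul_exp (2 * z.re)
    have h2 := hexp z hz
    have h3 : 2 * (Real.exp (2 * z.re) - 1) ≤ Real.exp (2 * b) * (4 * z.re) := by nlinarith
    calc _ ≤ Real.exp (2 * b) * (4 * z.re) * ‖deriv G z‖ ^ 2 := by gcongr
      _ = _ := by ring
  have hE : 0 ≤ rectIntegral (fun z => 4 * (z.re * ‖deriv G z‖ ^ 2)) a b c d :=
    rectIntegral_nonneg hab.le hcd.le (fun z hz => by positivity) ha
  set A := rectIntegral (fun z => 1 / z.re) a b c d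
  set σ := rectIntegral (fun w => 2 * Real.exp (2 * w.re) / (Real.exp (2 * w.re) - 1)) a b c d
  set q := rectIntegral (fun w => 2 * (Real.exp (2 * w.re) - 1) * ‖deriv G w‖ ^ 2) a b c d
  set E := rectIntegral (fun z => 4 * (z.re * ‖deriv G z‖ ^ 2)) a b c d
  have hσ : 0 < σ := hA.trans_le hσ1
  rw [le_div_iff₀ hσ] at hm
  have hM0 : 0 ≤ M := le_trans (div_nonneg (hE.trans hq1) hσ.le) hM
  rw [div_le_iff₀ hσ] at hM
  refine ⟨?_, ?_, hM0⟩
  · rcases le_total m 0 with h | h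
    · rw [max_eq_right h, zero_mul]; positivity
    · rw [max_eq_left h]
      calc m * A ≤ m * σ := by gcongr
        _ ≤ _ := hm.trans hq2
  · calc E ≤ q := hq1
      _ ≤ M * σ := hM
      _ ≤ M * (Real.exp (2 * b) * A) := by gcongr
      _ = _ := by ring

/-! ### The hypothesis on large boxes as a condition on rectangles. -/

theorem exp_sub_one_le_two_mul {x : ℝ} (hx : 0 ≤ x) (hx2 : x ≤ Real.log 2) :
    Real.exp x - 1 ≤ 2 * x := by
  have h1 := exp_sub_one_le_mul_exp x
  have h2 : Real.exp x ≤ 2 := by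
    rw [← Real.exp_log (zero_lt_two' ℝ)]; exact Real.exp_le_exp.2 hx2
  nlinarith

theorem hypDensity_ofReal (r : ℝ) : hypDensity (r : ℂ) = 2 / (r ^ 2 - 1) := by
  simp [hypDensity]

/-- For r ≤ 2 one has r + 1 ≤ 3, so the density is at least (2/3)/(r - 1), which integrates to a
logarithm; e^a - 1 ≤ 2a and e^b - 1 ≥ b then bound its argument. -/
theorem le_height_ofLog (ha : 0 < a) (hab : a < b) (hcd : c < d)
    (hd : d ≤ c + 2 * Real.pi) (hb : b ≤ Real.log 2) :
    2 / 3 * Real.log (b / (2 * a)) ≤ (AnnularBox.ofLog a b c d ha hab hcd hd).height := by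
  have hb0 := ha.trans hab
  have h1 : a ≤ Real.exp a - 1 := by linarith [Real.add_one_le_exp a]
  have h2 : b ≤ Real.exp b - 1 := by linarith [Real.add_one_le_exp b]
  have h3 := exp_sub_one_le_two_mul ha.le (hab.le.trans hb)
  have h4 : Real.exp b ≤ 2 := by
    rw [← Real.exp_log (zero_lt_two' ℝ)]; exact Real.exp_le_exp.2 hb
  have h5 : Real.exp a ≤ Real.exp b := Real.exp_le_exp.2 hab.le
  have hint : ∫ r in Real.exp a..Real.exp b, 2 / 3 * (1 / (r - 1)) =
      2 / 3 * Real.log ((Real.exp b - 1) / (Real.exp a - 1)) := by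
    rw [intervalIntegral.integral_const_mul,
      intervalIntegral.integral_comp_sub_right (fun r => 1 / r),
      integral_one_div_of_pos (by linarith) (by linarith)]
  calc 2 / 3 * Real.log (b / (2 * a))
      ≤ 2 / 3 * Real.log ((Real.exp b - 1) / (Real.exp a - 1)) := by
        have h6 : b / (2 * a) ≤ (Real.exp b - 1) / (Real.exp a - 1) :=
          div_le_div₀ (by linarith) h2 (by linarith) h3
        gcongr
    _ = ∫ r in Real.exp a..Real.exp b, 2 / 3 * (1 / (r - 1)) := hint.symm
    _ ≤ _ := by
        refine intervalIntegral.integral_mono_on h5 ?_ ?_ fun r hr => ?_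
        · refine ContinuousOn.intervalIntegrable_of_Icc h5 ?_
          refine continuousOn_const.mul (continuousOn_const.div (by fun_prop) fun r hr => ?_)
          linarith [hr.1]
        · refine ContinuousOn.intervalIntegrable_of_Icc h5 ?_
          simp only [hypDensity_ofReal]
          refine continuousOn_const.div (by fun_prop) fun r hr => ?_
          nlinarith [hr.1]
        · rw [hypDensity_ofReal, mul_one_div, div_div, div_le_div_iff₀]
          · nlinarith [hr.1, hr.2]
          · nlinarith [hr.1, hr.2]
          · nlinarith [hr.1, hr.2]

/-- With r = e^b, the factor 2r/(r² - 1) is at least 1/(r - 1), and r - 1 ≤ 2b. -/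
theorem le_width_ofLog (ha : 0 < a) (hab : a < b) (hcd : c < d)
    (hd : d ≤ c + 2 * Real.pi) (hb : b ≤ Real.log 2) :
    (d - c) / (2 * b) ≤ (AnnularBox.ofLog a b c d ha hab hcd hd).width := by
  have hb0 := ha.trans hab
  have h2 : b ≤ Real.exp b - 1 := by linarith [Real.add_one_le_exp b]
  have h3 := exp_sub_one_le_two_mul hb0.le hb
  have h5 : 1 / (2 * b) ≤ Real.exp b * (2 / (Real.exp b ^ 2 - 1)) := by
    rw [mul_div_assoc', div_le_div_iff₀ (by positivity) (by nlinarith)]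
    nlinarith
  change _ ≤ Real.exp b * hypDensity (Real.exp b : ℝ) * (d - c)
  rw [hypDensity_ofReal]
  calc (d - c) / (2 * b) = 1 / (2 * b) * (d - c) := by ring
    _ ≤ _ := mul_le_mul_of_nonneg_right h5 (by linarith)

/-- Rectangle form of the hypothesis on averages over large boxes. -/
def RectBounds (G : ℂ → ℂ) (m M l β S : ℝ) : Prop :=
  ∀ a b c d : ℝ, 0 < a → l * a ≤ b → b ≤ S → β * b ≤ d - c → d ≤ c + 2 * Real.pi →
    m * ((d - c) * Real.log (b / a)) ≤ Real.exp (2 * b) *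
        (4 * rectIntegral (fun w => w.re * ‖deriv G w‖ ^ 2) a b c d) ∧
      4 * rectIntegral (fun w => w.re * ‖deriv G w‖ ^ 2) a b c d ≤
        Real.exp (2 * b) * (M * ((d - c) * Real.log (b / a)))

theorem exists_rectBounds (hg : IsLogDerivBranch φ g) {m M : ℝ}
    (hbox : ForAllLargeBoxes fun B =>
      m ≤ B.average (fun z => ‖2 * nonlinearity φ z / (hypDensity z : ℂ)‖ ^ 2) ∧
        B.average (fun z => ‖2 * nonlinearity φ z / (hypDensity z : ℂ)‖ ^ 2) ≤ M) :
    0 ≤ M ∧ ∃ l β S : ℝ, 2 ≤ l ∧ 1 ≤ β ∧ 0 < S ∧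
      RectBounds (fun w => g (Complex.exp w)) (max m 0) M l β S := by
  obtain ⟨L, R, hR, h⟩ := hbox
  -- Raising L to at least 1 gives positive constants. Then b ≥ la yields height at least
  -- (2/3)log(l/2) = L₁, and d - c ≥ βb yields width at least β/2 = L₁.
  set L₁ := max L 1 with hL₁
  have hL1 : 1 ≤ L₁ := le_max_right _ _
  have hLL : L ≤ L₁ := le_max_left _ _
  set l := 2 * Real.exp (3 / 2 * L₁) with hl
  set β := 2 * L₁
  set S := min (Real.log R) (Real.log 2)
  have hS : 0 < S := lt_min (Real.log_pos hR) (Real.log_pos one_lt_two)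
  have hl2 : 2 ≤ l := by
    have := Real.one_le_exp (show 0 ≤ 3 / 2 * L₁ by linarith)
    linarith
  have key : ∀ a b c d : ℝ, 0 < a → l * a ≤ b → b ≤ S → β * b ≤ d - c → d ≤ c + 2 * Real.pi →
      max m 0 * ((d - c) * Real.log (b / a)) ≤ Real.exp (2 * b) *
        (4 * rectIntegral (fun w => w.re * ‖deriv (fun w => g (Complex.exp w)) w‖ ^ 2) a b c d) ∧
      4 * rectIntegral (fun w => w.re * ‖deriv (fun w => g (Complex.exp w)) w‖ ^ 2) a b c d ≤
        Real.exp (2 * b) * (M * ((d - c) * Real.log (b / a))) ∧ 0 ≤ M := by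
    intro a b c d ha hb hbS hβ hd
    have hab : a < b := by nlinarith
    have hb0 := ha.trans hab
    have hcd : c < d := by nlinarith [mul_pos (show 0 < β by linarith) hb0]
    have hbl : b ≤ Real.log 2 := hbS.trans (min_le_right _ _)
    have hbR : Real.exp b ≤ R := by
      rw [← Real.le_log_iff_exp_le (by linarith)]
      exact hbS.trans (min_le_left _ _)
    have hB := h (AnnularBox.ofLog a b c d ha hab hcd hd) hbR ?_ ?_
    · exact rect_bounds_of_average hg ha hab hcd hd hB.1 hB.2
    · refine le_trans ?_ (le_height_ofLog ha hab hcd hd hbl)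
      have h1 : 3 / 2 * L₁ ≤ Real.log (b / (2 * a)) := by
        rw [Real.le_log_iff_exp_le (by positivity), le_div_iff₀ (by positivity)]
        linarith
      linarith
    · refine le_trans ?_ (le_width_ofLog ha hab hcd hd hbl)
      rw [le_div_iff₀ (by positivity)]
      nlinarith
  refine ⟨?_, l, β, S, hl2, by linarith, hS, fun a b c d ha hb hbS hβ hd =>
    ⟨(key a b c d ha hb hbS hβ hd).1, (key a b c d ha hb hbS hβ hd).2.1⟩⟩
  have hβ : 0 < β := by linarith
  -- M ≥ 0 needs one admissible rectangle: b is small enough for the full period 2π to be at least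
  -- βb.
  set b := min S (2 * Real.pi / β)
  have hb : 0 < b := lt_min hS (by positivity)
  refine (key (b / l) b 0 (2 * Real.pi) (by positivity) (le_of_eq (by field_simp))
    (min_le_left _ _) ?_ (by linarith)).2.2
  have : b ≤ 2 * Real.pi / β := min_le_right _ _
  rw [le_div_iff₀ hβ] at this
  linarith

end Average

/-! ### The Bloch bound. -/

/-- The mean value property applied to h². The interval [-π, π] is the one used by polar
coordinates. -/
theorem norm_sq_le_integral_circle {h : ℂ → ℂ} {w : ℂ} {r : ℝ} (hr : 0 ≤ r)
    (hh : DiffContOnCl ℂ h (Metric.ball w r)) :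
    2 * Real.pi * ‖h w‖ ^ 2 ≤ ∫ θ in -Real.pi..Real.pi, ‖h (circleMap w r θ)‖ ^ 2 := by
  have h1 : DiffContOnCl ℂ (fun z => h z ^ 2) (Metric.ball w |r|) := by
    rw [abs_of_nonneg hr]
    simpa only [sq, smul_eq_mul] using hh.smul hh
  have h2 := h1.circleAverage
  rw [Real.circleAverage_def] at h2
  have hper : Function.Periodic (fun θ => ‖h (circleMap w r θ)‖ ^ 2) (2 * Real.pi) :=
    fun θ => by simp only [periodic_circleMap w r θ]
  have h3 := hper.intervalIntegral_add_eq 0 (-Real.pi)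
  rw [zero_add, show -Real.pi + 2 * Real.pi = Real.pi by ring] at h3
  rw [← h3]
  have h4 : 2 * Real.pi * ‖h w‖ ^ 2 =
      ‖∫ θ in (0 : ℝ)..2 * Real.pi, h (circleMap w r θ) ^ 2‖ := by
    rw [← norm_pow, ← h2, norm_smul, norm_inv, Real.norm_of_nonneg Real.two_pi_pos.le,
      mul_inv_cancel_left₀ Real.two_pi_pos.ne']
  rw [h4]
  refine (intervalIntegral.norm_integral_le_integral_norm Real.two_pi_pos.le).trans_eq ?_
  simp only [norm_pow]

/-- The area mean value inequality for holomorphic functions. -/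
theorem norm_sq_le_integral_ball {h : ℂ → ℂ} {w : ℂ} {R : ℝ} (hR : 0 < R)
    (hh : DifferentiableOn ℂ h (Metric.closedBall w R)) :
    Real.pi * R ^ 2 * ‖h w‖ ^ 2 ≤ ∫ z in Metric.ball w R, ‖h z‖ ^ 2 := by
  let F : ℝ × ℝ → ℝ := fun p => p.1 * ‖h (circleMap w p.1 p.2)‖ ^ 2
  have hFc : ContinuousOn F (Icc 0 R ×ˢ Icc (-Real.pi) Real.pi) := by
    refine continuousOn_fst.mul (ContinuousOn.pow (ContinuousOn.norm ?_) 2)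
    refine hh.continuousOn.comp (f := fun p : ℝ × ℝ => circleMap w p.1 p.2) ?_ ?_
    · simp only [circleMap]; fun_prop
    · rintro ⟨r, θ⟩ ⟨hr, -⟩
      exact (Metric.closedBall_subset_closedBall hr.2) (circleMap_mem_closedBall w hr.1 θ)
  have hFi : IntegrableOn F (Ioo 0 R ×ˢ Ioo (-Real.pi) Real.pi) (volume.prod volume) :=
    (hFc.integrableOn_compact (isCompact_Icc.prod isCompact_Icc)).mono_set
      (prod_mono Ioo_subset_Icc_self Ioo_subset_Icc_self)
  have h1 : ∫ z in Metric.ball w R, ‖h z‖ ^ 2 =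
      ∫ p in Ioo 0 R ×ˢ Ioo (-Real.pi) Real.pi, F p ∂(volume.prod volume) := by
    rw [← integral_indicator Metric.isOpen_ball.measurableSet,
      ← integral_add_left_eq_self _ w, ← Complex.integral_comp_polarCoord_symm,
      polarCoord_target]
    have hsub : Ioo 0 R ×ˢ Ioo (-Real.pi) Real.pi ⊆ Ioi (0 : ℝ) ×ˢ Ioo (-Real.pi) Real.pi :=
      prod_mono Ioo_subset_Ioi_self subset_rfl
    have hpolar : ∀ p : ℝ × ℝ, w + Complex.polarCoord.symm p = circleMap w p.1 p.2 := by
      intro p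
      rw [Complex.polarCoord_symm_apply, circleMap, Complex.exp_mul_I, Complex.ofReal_cos,
        Complex.ofReal_sin]
    simp only [hpolar]
    rw [setIntegral_eq_of_subset_of_forall_sdiff_eq_zero
      (measurableSet_Ioi.prod measurableSet_Ioo) hsub]
    · refine setIntegral_congr_fun (measurableSet_Ioo.prod measurableSet_Ioo) ?_
      rintro ⟨r, θ⟩ ⟨hr, -⟩
      have : circleMap w r θ ∈ Metric.ball w R := by
        rw [Metric.mem_ball, show dist (circleMap w r θ) w = |r| from circleMap_mem_sphere' w r θ,
          abs_of_pos hr.1]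
        exact hr.2
      simp [this, F]
    · rintro ⟨r, θ⟩ ⟨⟨hr, hθ⟩, hn⟩
      have hr0 : 0 < r := hr
      have : circleMap w r θ ∉ Metric.ball w R := by
        intro hmem
        rw [Metric.mem_ball, show dist (circleMap w r θ) w = |r| from circleMap_mem_sphere' w r θ,
          abs_of_pos hr0] at hmem
        exact hn ⟨⟨hr, hmem⟩, hθ⟩
      simp [this]
  rw [h1, setIntegral_prod _ hFi]
  have h2 : Real.pi * R ^ 2 * ‖h w‖ ^ 2 = ∫ r in Ioo 0 R, r * (2 * Real.pi * ‖h w‖ ^ 2) := by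
    rw [← integral_Ioc_eq_integral_Ioo, ← intervalIntegral.integral_of_le hR.le,
      intervalIntegral.integral_mul_const, integral_id]
    ring
  rw [h2]
  rw [IntegrableOn, ← Measure.prod_restrict] at hFi
  refine setIntegral_mono_on ?_ hFi.integral_prod_left measurableSet_Ioo fun r hr => ?_
  · exact (Continuous.integrableOn_Icc (by fun_prop)).mono_set Ioo_subset_Icc_self
  · simp only [F]
    rw [integral_const_mul, ← integral_Ioc_eq_integral_Ioo,
      ← intervalIntegral.integral_of_le (by linarith [Real.pi_pos])]
    refine mul_le_mul_of_nonneg_left (norm_sq_le_integral_circle hr.1.le ?_) hr.1.le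
    refine DifferentiableOn.diffContOnCl (hh.mono ?_)
    exact Metric.closure_ball_subset_closedBall.trans (Metric.closedBall_subset_closedBall hr.2.le)

/-- Upper bounds on averages give a pointwise (Bloch) bound. -/
theorem RectBounds.exists_bloch {G : ℂ → ℂ} (hG : DifferentiableOn ℂ G rightHalfPlane)
    {m M l β S : ℝ} (hl : 2 ≤ l) (hβ : 1 ≤ β) (hS : 0 < S) (h : RectBounds G m M l β S) :
    ∃ C S' : ℝ, 0 < C ∧ 0 < S' ∧ ∀ w : ℂ, 0 < w.re → w.re ≤ S' → w.re * ‖deriv G w‖ ≤ C := by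
  have hpi := Real.pi_gt_three
  -- The test rectangle around w, with s = Re w, is [s/l, ls] wide and lβs high: the minimal height
  -- for b = ls. The two minima make it admissible.
  refine ⟨|Real.exp (2 * S) * M * (l * β) * Real.log (l * l) * l| + 1,
    min (S / l) (2 * Real.pi / (l * β)), by positivity, lt_min (by positivity) (by positivity), ?_⟩
  intro w hw hwS
  set s := w.re with hs
  have hs1 : l * s ≤ S := by
    have := hwS.trans (min_le_left _ _); rw [le_div_iff₀ (by positivity)] at this; linarith
  have hs2 : l * β * s ≤ 2 * Real.pi := by
    have := hwS.trans (min_le_right _ _); rw [le_div_iff₀ (by positivity)] at this; linarith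
  set η := l * β * s / 2 with hη
  have hηs : s ≤ η := by
    have : 2 ≤ l * β := by nlinarith
    nlinarith
  have hsl : s / l ≤ s / 2 := by gcongr
  have hslpos : 0 < s / l := by positivity
  have hR := (h (s / l) (l * s) (w.im - η) (w.im + η) hslpos
    (by rw [mul_div_cancel₀ _ (by positivity)]; nlinarith) hs1 (by nlinarith) (by linarith)).2
  have hab : s / l ≤ l * s := by nlinarith
  have hcd : w.im - η ≤ w.im + η := by linarith
  have hcE := continuousOn_re_mul_norm_deriv_sq hG
  have hcEI := hcE.mono (reProdIm_subset_rightHalfPlane (b := l * s) hslpos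
    (Icc (w.im - η) (w.im + η)))
  -- The disk of radius s/2 fits because l ≥ 2 and the half-height η is at least s.
  have hball : Metric.ball w (s / 2) ⊆ Ioo (s / l) (l * s) ×ℂ Ioo (w.im - η) (w.im + η) := by
    intro z hz
    have hz' : ‖z - w‖ < s / 2 := by simpa [dist_eq_norm] using hz
    have h1 := (Complex.abs_re_le_norm (z - w)).trans_lt hz'
    have h2 := (Complex.abs_im_le_norm (z - w)).trans_lt hz'
    rw [abs_lt, Complex.sub_re] at h1
    rw [abs_lt, Complex.sub_im] at h2
    refine ⟨⟨?_, ?_⟩, ⟨?_, ?_⟩⟩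
    · change s / l < z.re; linarith
    · change z.re < l * s; nlinarith
    · change w.im - η < z.im; linarith
    · change z.im < w.im + η; linarith
  have hsub : Metric.closedBall w (s / 2) ⊆ rightHalfPlane := by
    intro z hz
    have hz' : ‖z - w‖ ≤ s / 2 := by simpa [dist_eq_norm] using hz
    have h1 := (Complex.abs_re_le_norm (z - w)).trans hz'
    rw [abs_le, Complex.sub_re] at h1
    change 0 < z.re
    linarith
  have hmv := norm_sq_le_integral_ball (half_pos hw)
    ((hG.deriv isOpen_rightHalfPlane).mono hsub)
  have hcompact : IsCompact (Icc (s / l) (l * s) ×ℂ Icc (w.im - η) (w.im + η)) :=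
    isCompact_Icc.reProdIm isCompact_Icc
  -- On the rectangle Re z ≥ s/l, so the factor (l/s)Re z is at least 1 and may be inserted.
  have hle : ∫ z in Metric.ball w (s / 2), ‖deriv G z‖ ^ 2 ≤
      l / s * rectIntegral (fun w => w.re * ‖deriv G w‖ ^ 2) (s / l) (l * s) (w.im - η)
        (w.im + η) := by
    rw [rectIntegral_eq_setIntegral hab hcd hcEI, ← integral_const_mul]
    have hI : IntegrableOn (fun z => l / s * (z.re * ‖deriv G z‖ ^ 2))
        (Ioo (s / l) (l * s) ×ℂ Ioo (w.im - η) (w.im + η)) :=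
      ((continuousOn_const.mul hcEI).integrableOn_compact hcompact).mono_set fun z hz =>
        ⟨Ioo_subset_Icc_self hz.1, Ioo_subset_Icc_self hz.2⟩
    refine le_trans ?_ (setIntegral_mono_set hI ?_ hball.eventuallyLE)
    · refine setIntegral_mono_on ?_ (hI.mono_set hball) measurableSet_ball fun z hz => ?_
      · exact (((continuousOn_deriv_rightHalfPlane hG).norm.pow 2).mono hsub
          |>.integrableOn_compact (isCompact_closedBall _ _)).mono_set Metric.ball_subset_closedBall
      · have h1 : s / l < z.re := (hball hz).1.1
        have h2 : 1 ≤ l / s * z.re := by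
          rw [div_mul_eq_mul_div, le_div_iff₀ hw]
          rw [div_lt_iff₀ (by positivity)] at h1
          linarith
        rw [← mul_assoc]
        exact le_mul_of_one_le_left (by positivity) h2
    · refine (ae_restrict_iff' (isOpen_Ioo.reProdIm isOpen_Ioo).measurableSet).2
        (Eventually.of_forall fun z hz => ?_)
      have h1 : 0 < z.re := hslpos.trans hz.1.1
      change 0 ≤ l / s * (z.re * ‖deriv G z‖ ^ 2)
      positivity
  set E := rectIntegral (fun w => w.re * ‖deriv G w‖ ^ 2) (s / l) (l * s) (w.im - η) (w.im + η)
  have hll : l * s / (s / l) = l * l := by field_simp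
  rw [hll, show w.im + η - (w.im - η) = l * β * s by rw [hη]; ring] at hR
  set X := |Real.exp (2 * S) * M * (l * β) * Real.log (l * l) * l|
  have hE : 4 * E ≤ |Real.exp (2 * S) * M * (l * β) * Real.log (l * l) * l| / l * s := by
    have hlog : 0 ≤ Real.log (l * l) := Real.log_nonneg (by nlinarith)
    have h1 : Real.exp (2 * (l * s)) ≤ Real.exp (2 * S) := Real.exp_le_exp.2 (by linarith)
    calc 4 * E ≤ Real.exp (2 * (l * s)) * (M * (l * β * s * Real.log (l * l))) := hR
      _ ≤ Real.exp (2 * (l * s)) * (|M| * (l * β * s * Real.log (l * l))) := by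
          gcongr; exact le_abs_self M
      _ ≤ Real.exp (2 * S) * (|M| * (l * β * s * Real.log (l * l))) := by gcongr
      _ = _ := by
          simp only [abs_mul, Real.abs_exp]
          rw [abs_of_pos (show 0 < l by linarith), abs_of_pos (show 0 < β by linarith),
            abs_of_nonneg hlog]
          field_simp
  have hX : Real.pi * (s / 2) ^ 2 * ‖deriv G w‖ ^ 2 ≤ X / 4 := by
    calc _ ≤ l / s * E := hmv.trans hle
      _ ≤ l / s * (X / l * s / 4) := by gcongr; linarith
      _ = X / 4 := by field_simp
  have hX0 : 0 ≤ X := abs_nonneg _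
  have hfin : (s * ‖deriv G w‖) ^ 2 ≤ (X + 1) ^ 2 := by
    have h1 : (s * ‖deriv G w‖) ^ 2 * Real.pi ≤ X := by nlinarith
    nlinarith [sq_nonneg (s * ‖deriv G w‖)]
  exact le_of_sq_le_sq hfin (by linarith)

/-! ### Inserting the weight |exp(pG)| and summing over a strip. -/

section Window

variable {G : ℂ → ℂ} {p : ℂ}

theorem convex_reProdIm_Icc (a b c d : ℝ) : Convex ℝ (Icc a b ×ℂ Icc c d) :=
  ((convex_Icc a b).linear_preimage Complex.reLm).inter
    ((convex_Icc c d).linear_preimage Complex.imLm)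

/-- The weight `|exp (p G)|` oscillates little on rectangles of bounded hyperbolic size. -/
theorem norm_exp_mul_le_of_bloch (hG : DifferentiableOn ℂ G rightHalfPlane) {C S' : ℝ}
    (hC : ∀ w : ℂ, 0 < w.re → w.re ≤ S' → w.re * ‖deriv G w‖ ≤ C) {a b c d δ : ℝ}
    (ha : 0 < a) (hbS : b ≤ S') (hδ : ‖p‖ * (C / a * ((b - a) + (d - c))) ≤ δ) {z w : ℂ}
    (hz : z ∈ Icc a b ×ℂ Icc c d) (hw : w ∈ Icc a b ×ℂ Icc c d) :
    ‖Complex.exp (p * G z)‖ ≤ Real.exp δ * ‖Complex.exp (p * G w)‖ := by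
  have hsub := reProdIm_subset_rightHalfPlane (b := b) ha (Icc c d)
  have h1 : ‖G z - G w‖ ≤ C / a * ‖z - w‖ := by
    refine (convex_reProdIm_Icc a b c d).norm_image_sub_le_of_norm_deriv_le
      (fun x hx => hG.differentiableAt (isOpen_rightHalfPlane.mem_nhds (hsub hx))) ?_ hw hz
    intro x hx
    have hx1 : a ≤ x.re := hx.1.1
    have h2 := hC x (hsub hx) (hx.1.2.trans hbS)
    rw [le_div_iff₀ ha]
    nlinarith [norm_nonneg (deriv G x)]
  have hC0 : 0 ≤ C / a := by
    have h2 := hC z (hsub hz) (hz.1.2.trans hbS)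
    have h3 : 0 < z.re := hsub hz
    exact div_nonneg (le_trans (by positivity) h2) ha.le
  have h2 : ‖z - w‖ ≤ (b - a) + (d - c) := by
    refine (Complex.norm_le_abs_re_add_abs_im _).trans (add_le_add ?_ ?_)
    · rw [Complex.sub_re]
      exact abs_sub_le_of_le_of_le hz.1.1 hz.1.2 hw.1.1 hw.1.2
    · rw [Complex.sub_im]
      exact abs_sub_le_of_le_of_le hz.2.1 hz.2.2 hw.2.1 hw.2.2
  rw [Complex.norm_exp, Complex.norm_exp, ← Real.exp_add, Real.exp_le_exp]
  have h3 : (p * G z).re - (p * G w).re ≤ ‖p‖ * ‖G z - G w‖ := by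
    rw [← Complex.sub_re, ← mul_sub, ← norm_mul]
    exact Complex.re_le_norm _
  have h4 : ‖p‖ * ‖G z - G w‖ ≤ δ := by
    refine le_trans ?_ hδ
    gcongr
    exact h1.trans (by gcongr)
  linarith

theorem continuousOn_weighted_energy (hG : DifferentiableOn ℂ G rightHalfPlane) :
    ContinuousOn (fun z => z.re * (‖deriv G z‖ ^ 2 * ‖Complex.exp (p * G z)‖)) rightHalfPlane :=
  Complex.continuous_re.continuousOn.mul (continuousOn_energy_density hG)

theorem continuousOn_weighted_mean (hG : DifferentiableOn ℂ G rightHalfPlane) :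
    ContinuousOn (fun z => 1 / z.re * ‖Complex.exp (p * G z)‖) rightHalfPlane :=
  continuousOn_one_div_re.mul (continuousOn_norm_exp_mul hG)

/-- The comparison of weighted energy and weighted mean on one rectangle. -/
theorem RectBounds.weighted (hG : DifferentiableOn ℂ G rightHalfPlane) {C S' m M l β S : ℝ}
    (hm : 0 ≤ m) (hM : 0 ≤ M) (hl : 1 ≤ l) (hβ : 0 < β) (h : RectBounds G m M l β S)
    (hC : ∀ w : ℂ, 0 < w.re → w.re ≤ S' → w.re * ‖deriv G w‖ ≤ C) {a b c d δ : ℝ}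
    (ha : 0 < a) (hab : l * a ≤ b) (hbS : b ≤ S) (hbS' : b ≤ S')
    (hcd : β * b ≤ d - c) (hd : d ≤ c + 2 * Real.pi)
    (hδ : ‖p‖ * (C / a * ((b - a) + (d - c))) ≤ δ) :
    m * rectIntegral (fun z => 1 / z.re * ‖Complex.exp (p * G z)‖) a b c d ≤
      Real.exp (2 * b + 2 * δ) * (4 * rectIntegral
        (fun z => z.re * (‖deriv G z‖ ^ 2 * ‖Complex.exp (p * G z)‖)) a b c d) ∧
    4 * rectIntegral (fun z => z.re * (‖deriv G z‖ ^ 2 * ‖Complex.exp (p * G z)‖)) a b c d ≤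
      Real.exp (2 * b + 2 * δ) *
        (M * rectIntegral (fun z => 1 / z.re * ‖Complex.exp (p * G z)‖) a b c d) := by
  have hab' : a ≤ b := by nlinarith
  have hb : 0 < b := ha.trans_le hab'
  have hcd' : c ≤ d := by nlinarith
  obtain ⟨h1, h2⟩ := h a b c d ha hab hbS hcd hd
  rw [← rectIntegral_one_div_re ha hb] at h1 h2
  have hosc := fun z (hz : z ∈ Icc a b ×ℂ Icc c d) w (hw : w ∈ Icc a b ×ℂ Icc c d) =>
    norm_exp_mul_le_of_bloch (p := p) hG hC ha hbS' hδ hz hw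
  -- The weight is frozen at a corner. Freezing and unfreezing each cost a factor e^δ, whence e^{2δ}
  -- in the conclusion.
  set w₀ : ℂ := a + c * Complex.I with hw₀
  have hw₀mem : w₀ ∈ Icc a b ×ℂ Icc c d := ⟨by simp [hw₀, hab'], by simp [hw₀, hcd']⟩
  set α := ‖Complex.exp (p * G w₀)‖ with hα
  have hα0 : 0 ≤ α := norm_nonneg _
  have hpos : ∀ z ∈ Icc a b ×ℂ Icc c d, 0 < z.re := fun z hz => ha.trans_le hz.1.1
  have hcE := continuousOn_re_mul_norm_deriv_sq hG
  have hcE' := continuousOn_weighted_energy (p := p) hG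
  have hcA' := continuousOn_weighted_mean (p := p) hG
  have hE1 : rectIntegral (fun z => z.re * (‖deriv G z‖ ^ 2 * ‖Complex.exp (p * G z)‖)) a b c d ≤
      Real.exp δ * α * rectIntegral (fun w => w.re * ‖deriv G w‖ ^ 2) a b c d := by
    rw [← rectIntegral_const_mul]
    refine rectIntegral_mono ha hab' hcd' hcE' (continuousOn_const.mul hcE) fun z hz => ?_
    have := hpos z hz
    calc _ = z.re * ‖deriv G z‖ ^ 2 * ‖Complex.exp (p * G z)‖ := by ring
      _ ≤ z.re * ‖deriv G z‖ ^ 2 * (Real.exp δ * α) := by gcongr; exact hosc z hz w₀ hw₀mem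
      _ = _ := by ring
  have hE2 : α * rectIntegral (fun w => w.re * ‖deriv G w‖ ^ 2) a b c d ≤ Real.exp δ *
      rectIntegral (fun z => z.re * (‖deriv G z‖ ^ 2 * ‖Complex.exp (p * G z)‖)) a b c d := by
    rw [← rectIntegral_const_mul, ← rectIntegral_const_mul]
    refine rectIntegral_mono ha hab' hcd' (continuousOn_const.mul hcE)
      (continuousOn_const.mul hcE') fun z hz => ?_
    have := hpos z hz
    calc α * (z.re * ‖deriv G z‖ ^ 2)
        ≤ (Real.exp δ * ‖Complex.exp (p * G z)‖) * (z.re * ‖deriv G z‖ ^ 2) := by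
          gcongr; exact hosc w₀ hw₀mem z hz
      _ = _ := by ring
  have hA1 : rectIntegral (fun z => 1 / z.re * ‖Complex.exp (p * G z)‖) a b c d ≤
      Real.exp δ * α * rectIntegral (fun z => 1 / z.re) a b c d := by
    rw [← rectIntegral_const_mul]
    refine rectIntegral_mono ha hab' hcd' hcA' (continuousOn_const.mul continuousOn_one_div_re)
      fun z hz => ?_
    have := hpos z hz
    rw [mul_comm]
    gcongr
    exact hosc z hz w₀ hw₀mem
  have hA2 : α * rectIntegral (fun z => 1 / z.re) a b c d ≤
      Real.exp δ * rectIntegral (fun z => 1 / z.re * ‖Complex.exp (p * G z)‖) a b c d := by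
    rw [← rectIntegral_const_mul, ← rectIntegral_const_mul]
    refine rectIntegral_mono ha hab' hcd' (continuousOn_const.mul continuousOn_one_div_re)
      (continuousOn_const.mul hcA') fun z hz => ?_
    have := hpos z hz
    calc α * (1 / z.re) ≤ (Real.exp δ * ‖Complex.exp (p * G z)‖) * (1 / z.re) := by
          gcongr; exact hosc w₀ hw₀mem z hz
      _ = _ := by ring
  set E := rectIntegral (fun w => w.re * ‖deriv G w‖ ^ 2) a b c d
  set E' := rectIntegral (fun z => z.re * (‖deriv G z‖ ^ 2 * ‖Complex.exp (p * G z)‖)) a b c d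
  set A := rectIntegral (fun z => 1 / z.re) a b c d
  set A' := rectIntegral (fun z => 1 / z.re * ‖Complex.exp (p * G z)‖) a b c d
  have hexp : Real.exp (2 * b + 2 * δ) = Real.exp δ * Real.exp δ * Real.exp (2 * b) := by
    rw [← Real.exp_add, ← Real.exp_add]; ring_nf
  rw [hexp]
  constructor
  · calc m * A' ≤ m * (Real.exp δ * α * A) := by gcongr
      _ = Real.exp δ * α * (m * A) := by ring
      _ ≤ Real.exp δ * α * (Real.exp (2 * b) * (4 * E)) := by gcongr
      _ = 4 * Real.exp δ * Real.exp (2 * b) * (α * E) := by ring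
      _ ≤ 4 * Real.exp δ * Real.exp (2 * b) * (Real.exp δ * E') := by gcongr
      _ = _ := by ring
  · calc 4 * E' ≤ 4 * (Real.exp δ * α * E) := by gcongr
      _ = Real.exp δ * α * (4 * E) := by ring
      _ ≤ Real.exp δ * α * (Real.exp (2 * b) * (M * A)) := by gcongr
      _ = M * Real.exp δ * Real.exp (2 * b) * (α * A) := by ring
      _ ≤ M * Real.exp δ * Real.exp (2 * b) * (Real.exp δ * A') := by gcongr
      _ = _ := by ring

theorem rectIntegral_eq_sum {f : ℂ → ℝ} (hf : ContinuousOn f rightHalfPlane) {a b w : ℝ}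
    (ha : 0 < a) (hab : a ≤ b) (hw : 0 ≤ w) (N : ℕ) :
    rectIntegral f a b 0 (N * w) =
      ∑ j ∈ Finset.range N, rectIntegral f a b (j * w) ((j + 1 : ℕ) * w) := by
  have h := intervalIntegral.sum_integral_adjacent_intervals (n := N)
    (f := fun y : ℝ => ∫ x in a..b, f (x + y * Complex.I)) (μ := volume)
    (a := fun j : ℕ => (j : ℝ) * w) fun j _ => intervalIntegrable_integral_left hab
      (by push_cast; linarith) (hf.mono (reProdIm_subset_rightHalfPlane ha _))
  simp only [Nat.cast_zero, zero_mul] at h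
  exact h.symm

/-- The comparison of weighted energy and weighted mean on an annulus. -/
theorem RectBounds.exists_annulus (hG : DifferentiableOn ℂ G rightHalfPlane)
    {C S' m M l β S : ℝ} (hm : 0 ≤ m) (hM : 0 ≤ M) (hl : 1 ≤ l) (hβ : 0 < β) (hS : 0 < S)
    (hC0 : 0 < C) (hS' : 0 < S') (h : RectBounds G m M l β S)
    (hC : ∀ w : ℂ, 0 < w.re → w.re ≤ S' → w.re * ‖deriv G w‖ ≤ C) :
    ∃ D T : ℝ, 0 < D ∧ 0 < T ∧ ∀ (p : ℂ) (b : ℝ), 0 < b → b ≤ T →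
      m * (∫ x in b / l..b, 1 / x * verticalMean G p x) ≤ Real.exp (2 * b + 2 * (D * ‖p‖)) *
        (4 * ∫ x in b / l..b, x * verticalEnergy G p x) ∧
      4 * (∫ x in b / l..b, x * verticalEnergy G p x) ≤ Real.exp (2 * b + 2 * (D * ‖p‖)) *
        (M * ∫ x in b / l..b, 1 / x * verticalMean G p x) := by
  -- Tiles of height at most 2βb give oscillation at most |p|·C/(b/l)·(b + 2βb) = C l (1 + 2β)|p|,
  -- uniformly in b.
  refine ⟨C * l * (1 + 2 * β), min (min S S') (2 * Real.pi / β), by positivity, by positivity, ?_⟩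
  intro p b hb hbT
  have hbS : b ≤ S := hbT.trans ((min_le_left _ _).trans (min_le_left _ _))
  have hbS' : b ≤ S' := hbT.trans ((min_le_left _ _).trans (min_le_right _ _))
  have hbβ : β * b ≤ 2 * Real.pi := by
    have := hbT.trans (min_le_right _ _); rw [le_div_iff₀ hβ] at this; linarith
  have ha : 0 < b / l := by positivity
  have hab : b / l ≤ b := div_le_self hb.le hl
  have hcE := continuousOn_weighted_energy (p := p) hG
  have hcA := continuousOn_weighted_mean (p := p) hG
  have hpi := Real.two_pi_pos
  have hA : ∫ x in b / l..b, 1 / x * verticalMean G p x =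
      rectIntegral (fun z => 1 / z.re * ‖Complex.exp (p * G z)‖) (b / l) b 0 (2 * Real.pi) := by
    rw [rectIntegral, intervalIntegral_swap_of_continuousOn hab hpi.le
      (hcA.mono (reProdIm_subset_rightHalfPlane ha _))]
    simp [verticalMean, intervalIntegral.integral_const_mul]
  have hE : ∫ x in b / l..b, x * verticalEnergy G p x =
      rectIntegral (fun z => z.re * (‖deriv G z‖ ^ 2 * ‖Complex.exp (p * G z)‖))
        (b / l) b 0 (2 * Real.pi) := by
    rw [rectIntegral, intervalIntegral_swap_of_continuousOn hab hpi.le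
      (hcE.mono (reProdIm_subset_rightHalfPlane ha _))]
    simp [verticalEnergy, intervalIntegral.integral_const_mul]
  rw [hA, hE]
  -- The period is cut into N equal tiles of height w. Rounding down gives w ≥ βb, so tiles are
  -- admissible, and N ≥ 1 gives w ≤ 2βb.
  set N := ⌊2 * Real.pi / (β * b)⌋₊ with hN
  have hβb : 0 < β * b := by positivity
  have hN1 : 1 ≤ N := by
    rw [hN, Nat.one_le_floor_iff]
    exact (one_le_div hβb).2 hbβ
  have hN1' : (1 : ℝ) ≤ N := by exact_mod_cast hN1
  have hNle : N * (β * b) ≤ 2 * Real.pi := by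
    rw [← le_div_iff₀ hβb]; exact Nat.floor_le (by positivity)
  have hNlt : 2 * Real.pi < (N + 1) * (β * b) := by
    rw [← div_lt_iff₀ hβb]; exact Nat.lt_floor_add_one _
  set w := 2 * Real.pi / N with hw
  have hNw : N * w = 2 * Real.pi := by rw [hw]; field_simp
  have hw0 : 0 ≤ w := by positivity
  have hw1 : β * b ≤ w := by rw [hw, le_div_iff₀ (by linarith)]; linarith
  have hw2 : w ≤ 2 * (β * b) := by
    rw [hw, div_le_iff₀ (by linarith)]; nlinarith
  have hwpi : w ≤ 2 * Real.pi := div_le_self hpi.le hN1'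
  have htile : ∀ j : ℕ, _ := fun j => h.weighted (p := p) hG hm hM hl hβ hC
    (c := j * w) (d := (j + 1 : ℕ) * w) (δ := C * l * (1 + 2 * β) * ‖p‖) ha
    (mul_div_cancel₀ _ (by positivity)).le hbS hbS' (by push_cast; linarith)
    (by push_cast; linarith) (by
      have h1 : (b - b / l) + (((j + 1 : ℕ) : ℝ) * w - j * w) ≤ b * (1 + 2 * β) := by
        push_cast; linarith
      calc ‖p‖ * (C / (b / l) * ((b - b / l) + (((j + 1 : ℕ) : ℝ) * w - j * w)))
          ≤ ‖p‖ * (C / (b / l) * (b * (1 + 2 * β))) := by gcongr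
        _ = _ := by field_simp)
  rw [← hNw, rectIntegral_eq_sum hcE ha hab hw0, rectIntegral_eq_sum hcA ha hab hw0]
  simp only [Finset.mul_sum]
  exact ⟨Finset.sum_le_sum fun j _ => (htile j).1, Finset.sum_le_sum fun j _ => (htile j).2⟩

end Window

/-! ### Iteration along geometric scales. -/

section Growth

variable {K : ℝ → ℝ} {T l y : ℝ}

/-- Iterate the step to T/lⁿ, with n the least integer putting this at or below s, and return to s
by monotonicity. Rounding up costs the extra y. -/
theorem log_le_of_geometric_growth (hl : 1 < l) (hy : 0 ≤ y)
    (hpos : ∀ s, 0 < s → s ≤ T → 0 < K s) (hanti : AntitoneOn K (Ioc 0 T))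
    (hstep : ∀ b, 0 < b → b ≤ T → K (b / l) ≤ Real.exp y * K b) {s : ℝ} (hs : 0 < s)
    (hsT : s ≤ T) :
    Real.log (K s) ≤ Real.log (K T) + y * (Real.log (T / s) / Real.log l + 1) := by
  have hT : 0 < T := hs.trans_le hsT
  have hlog : 0 < Real.log l := Real.log_pos hl
  have hl0 : 0 < l := by linarith
  have hmem : ∀ n : ℕ, 0 < T / l ^ n ∧ T / l ^ n ≤ T := fun n =>
    ⟨by positivity, div_le_self hT.le (one_le_pow₀ hl.le)⟩
  have hind : ∀ n : ℕ, Real.log (K (T / l ^ n)) ≤ Real.log (K T) + n * y := by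
    intro n
    induction n with
    | zero => simp
    | succ n ih =>
      have h1 := hstep _ (hmem n).1 (hmem n).2
      rw [div_div, ← pow_succ] at h1
      have h2 := Real.log_le_log (hpos _ (hmem (n + 1)).1 (hmem (n + 1)).2) h1
      rw [Real.log_mul (Real.exp_ne_zero _) (hpos _ (hmem n).1 (hmem n).2).ne', Real.log_exp] at h2
      push_cast
      linarith
  set n := ⌈Real.log (T / s) / Real.log l⌉₊ with hn
  have hn1 : Real.log (T / s) / Real.log l ≤ n := Nat.le_ceil _
  have hn2 : (n : ℝ) < Real.log (T / s) / Real.log l + 1 :=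
    Nat.ceil_lt_add_one (div_nonneg (Real.log_nonneg ((one_le_div hs).2 hsT)) hlog.le)
  have hle : T / l ^ n ≤ s := by
    rw [div_le_iff₀ hlog, ← Real.log_pow, Real.log_le_log_iff (by positivity) (by positivity),
      div_le_iff₀ hs] at hn1
    rw [div_le_iff₀ (by positivity)]
    linarith
  have h1 := Real.log_le_log (hpos s hs hsT) (hanti (hmem n) ⟨hs, hsT⟩ hle)
  have h2 := hind n
  nlinarith

/-- The mirror argument, with n rounded down so that T/lⁿ ≥ s; rounding loses one y. -/
theorem le_log_of_geometric_growth (hl : 1 < l) (hy : 0 ≤ y)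
    (hpos : ∀ s, 0 < s → s ≤ T → 0 < K s) (hanti : AntitoneOn K (Ioc 0 T))
    (hstep : ∀ b, 0 < b → b ≤ T → Real.exp y * K b ≤ K (b / l)) {s : ℝ} (hs : 0 < s)
    (hsT : s ≤ T) :
    Real.log (K T) + y * (Real.log (T / s) / Real.log l - 1) ≤ Real.log (K s) := by
  have hT : 0 < T := hs.trans_le hsT
  have hlog : 0 < Real.log l := Real.log_pos hl
  have hl0 : 0 < l := by linarith
  have hmem : ∀ n : ℕ, 0 < T / l ^ n ∧ T / l ^ n ≤ T := fun n =>
    ⟨by positivity, div_le_self hT.le (one_le_pow₀ hl.le)⟩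
  have hind : ∀ n : ℕ, Real.log (K T) + n * y ≤ Real.log (K (T / l ^ n)) := by
    intro n
    induction n with
    | zero => simp
    | succ n ih =>
      have h1 := hstep _ (hmem n).1 (hmem n).2
      rw [div_div, ← pow_succ] at h1
      have hK := hpos _ (hmem n).1 (hmem n).2
      have h2 := Real.log_le_log (mul_pos (Real.exp_pos y) hK) h1
      rw [Real.log_mul (Real.exp_ne_zero _) hK.ne', Real.log_exp] at h2
      push_cast
      linarith
  set n := ⌊Real.log (T / s) / Real.log l⌋₊ with hn
  have hn1 : n ≤ Real.log (T / s) / Real.log l :=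
    Nat.floor_le (div_nonneg (Real.log_nonneg ((one_le_div hs).2 hsT)) hlog.le)
  have hn2 : Real.log (T / s) / Real.log l < n + 1 := Nat.lt_floor_add_one _
  have hle : s ≤ T / l ^ n := by
    rw [le_div_iff₀ hlog, ← Real.log_pow, Real.log_le_log_iff (by positivity) (by positivity),
      le_div_iff₀ hs] at hn1
    rw [le_div_iff₀ (by positivity)]
    linarith
  have h1 := Real.log_le_log (hpos _ (hmem n).1 (hmem n).2) (hanti ⟨hs, hsT⟩ (hmem n) hle)
  have h2 := hind n
  nlinarith

end Growth

/-! ### The function I - sI' and two-sided growth bounds. -/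

section Convexity

variable {G : ℂ → ℂ} {p : ℂ}

/-- The quantity `I - s I'`, for `I` the vertical mean. -/
noncomputable def legendreMean (G : ℂ → ℂ) (p : ℂ) (s : ℝ) : ℝ :=
  verticalMean G p s - s * verticalMeanDeriv G p s

theorem hasDerivAt_legendreMean (hG : DifferentiableOn ℂ G rightHalfPlane)
    (hper : ∀ w ∈ rightHalfPlane, G (w + 2 * Real.pi * Complex.I) = G w) {s : ℝ} (hs : 0 < s) :
    HasDerivAt (legendreMean G p) (-(‖p‖ ^ 2 * (s * verticalEnergy G p s))) s := by
  have h := (hasDerivAt_verticalMean (p := p) hG hs).sub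
    ((hasDerivAt_id s).mul (hasDerivAt_verticalMeanDeriv (p := p) hG hper hs))
  exact h.congr_deriv (by simp only [id]; ring)

theorem antitoneOn_legendreMean (hG : DifferentiableOn ℂ G rightHalfPlane)
    (hper : ∀ w ∈ rightHalfPlane, G (w + 2 * Real.pi * Complex.I) = G w) :
    AntitoneOn (legendreMean G p) (Ioi 0) := by
  have hd := fun (s : ℝ) (hs : 0 < s) => hasDerivAt_legendreMean (p := p) hG hper hs
  refine antitoneOn_of_deriv_nonpos (convex_Ioi 0)
    (fun s hs => (hd s hs).continuousAt.continuousWithinAt)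
    (fun s hs => (hd s (interior_subset hs)).differentiableAt.differentiableWithinAt) ?_
  intro s hs
  have hs0 : 0 < s := interior_subset hs
  rw [(hd s hs0).deriv]
  have := verticalEnergy_nonneg (G := G) (p := p) s
  exact neg_nonpos.2 (by positivity)

/-- K' = -sI'' and Hardy's identity: the increment of K across a window is the weighted energy
there, with no boundary terms. -/
theorem legendreMean_sub (hG : DifferentiableOn ℂ G rightHalfPlane)
    (hper : ∀ w ∈ rightHalfPlane, G (w + 2 * Real.pi * Complex.I) = G w) {a b : ℝ}
    (ha : 0 < a) (hab : a ≤ b) :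
    legendreMean G p a - legendreMean G p b =
      ‖p‖ ^ 2 * ∫ x in a..b, x * verticalEnergy G p x := by
  have hI : IntervalIntegrable (verticalEnergy G p) volume a b :=
    intervalIntegrable_integral_right hab Real.two_pi_pos.le
      ((continuousOn_energy_density hG).mono (reProdIm_subset_rightHalfPlane ha _))
  have h := intervalIntegral.integral_eq_sub_of_hasDerivAt (a := a) (b := b)
    (f := legendreMean G p) (f' := fun s => -(‖p‖ ^ 2 * (s * verticalEnergy G p s)))
    (fun s hs => hasDerivAt_legendreMean hG hper (by
      rw [uIcc_of_le hab] at hs; exact ha.trans_le hs.1))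
    ((hI.continuousOn_mul continuousOn_id).const_mul _).neg
  rw [intervalIntegral.integral_neg, intervalIntegral.integral_const_mul] at h
  linarith

/-- The Bloch bound applied pointwise under the integral. It makes K = I - sI' comparable to I when
|p| is small. -/
theorem abs_mul_verticalMeanDeriv_le (hG : DifferentiableOn ℂ G rightHalfPlane) {C S' s : ℝ}
    (hC : ∀ w : ℂ, 0 < w.re → w.re ≤ S' → w.re * ‖deriv G w‖ ≤ C) (hs : 0 < s) (hsS : s ≤ S') :
    |s * verticalMeanDeriv G p s| ≤ C * ‖p‖ * verticalMean G p s := by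
  rw [verticalMeanDeriv, verticalMean, ← intervalIntegral.integral_const_mul,
    ← intervalIntegral.integral_const_mul, ← Real.norm_eq_abs]
  refine intervalIntegral.norm_integral_le_of_norm_le Real.two_pi_pos.le
    (Eventually.of_forall fun θ _ => ?_)
    ((((continuousOn_norm_exp_mul hG).comp_vertical hs).intervalIntegrable _ _).const_mul _)
  rw [← mul_assoc, norm_mul, norm_norm, norm_mul, Real.norm_of_nonneg hs.le, Real.norm_eq_abs]
  have h1 : |(p * deriv G (s + θ * Complex.I)).re| ≤ ‖p‖ * ‖deriv G (s + θ * Complex.I)‖ := by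
    rw [← norm_mul]; exact Complex.abs_re_le_norm _
  have h2 := hC (s + θ * Complex.I) (by simpa using hs) (by simpa using hsS)
  simp only [Complex.add_re, Complex.ofReal_re, Complex.mul_re, Complex.I_re, mul_zero,
    Complex.ofReal_im, Complex.I_im, mul_one, sub_self, add_zero] at h2
  refine mul_le_mul_of_nonneg_right ?_ (norm_nonneg _)
  calc s * |(p * deriv G (s + θ * Complex.I)).re|
      ≤ s * (‖p‖ * ‖deriv G (s + θ * Complex.I)‖) := by gcongr
    _ = s * ‖deriv G (s + θ * Complex.I)‖ * ‖p‖ := by ring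
    _ ≤ C * ‖p‖ := by gcongr

theorem legendreMean_bounds (hG : DifferentiableOn ℂ G rightHalfPlane) {C S' s : ℝ}
    (hC : ∀ w : ℂ, 0 < w.re → w.re ≤ S' → w.re * ‖deriv G w‖ ≤ C) (hs : 0 < s) (hsS : s ≤ S') :
    (1 - C * ‖p‖) * verticalMean G p s ≤ legendreMean G p s ∧
      legendreMean G p s ≤ (1 + C * ‖p‖) * verticalMean G p s := by
  have h := abs_le.1 (abs_mul_verticalMeanDeriv_le (p := p) hG hC hs hsS)
  rw [legendreMean]
  constructor <;> nlinarith [h.1, h.2]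

theorem continuousOn_verticalMean (hG : DifferentiableOn ℂ G rightHalfPlane) :
    ContinuousOn (verticalMean G p) (Ioi 0) :=
  fun _ hs => (hasDerivAt_verticalMean hG hs).continuousAt.continuousWithinAt

theorem integral_mean_div_bounds (hG : DifferentiableOn ℂ G rightHalfPlane) {a b u v : ℝ}
    (ha : 0 < a) (hab : a ≤ b) (hu : ∀ x ∈ Icc a b, u ≤ verticalMean G p x)
    (hv : ∀ x ∈ Icc a b, verticalMean G p x ≤ v) :
    u * Real.log (b / a) ≤ ∫ x in a..b, 1 / x * verticalMean G p x ∧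
      ∫ x in a..b, 1 / x * verticalMean G p x ≤ v * Real.log (b / a) := by
  have hsub : Icc a b ⊆ Ioi 0 := fun x hx => ha.trans_le hx.1
  have hc1 : ContinuousOn (fun x : ℝ => 1 / x) (Icc a b) :=
    continuousOn_const.div continuousOn_id fun x hx => (hsub hx).ne'
  have hI : IntervalIntegrable (fun x => 1 / x * verticalMean G p x) volume a b :=
    (hc1.mul ((continuousOn_verticalMean hG).mono hsub)).intervalIntegrable_of_Icc hab
  have hconst : ∀ r : ℝ, r * Real.log (b / a) = ∫ x in a..b, 1 / x * r := by
    intro r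
    rw [intervalIntegral.integral_mul_const, integral_one_div_of_pos ha (ha.trans_le hab), mul_comm]
  have hIc : ∀ r : ℝ, IntervalIntegrable (fun x => 1 / x * r) volume a b := fun r =>
    (hc1.mul continuousOn_const).intervalIntegrable_of_Icc hab
  rw [hconst, hconst]
  constructor
  · refine intervalIntegral.integral_mono_on hab (hIc u) hI fun x hx => ?_
    have : 0 < x := hsub hx
    gcongr
    exact hu x hx
  · refine intervalIntegral.integral_mono_on hab hI (hIc v) fun x hx => ?_
    have : 0 < x := hsub hx
    gcongr
    exact hv x hx

/-- Two-sided logarithmic growth bounds for the vertical mean. -/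
theorem exists_growth_bounds (hG : DifferentiableOn ℂ G rightHalfPlane)
    (hper : ∀ w ∈ rightHalfPlane, G (w + 2 * Real.pi * Complex.I) = G w)
    {m M l C S' D T : ℝ} (hm : 0 ≤ m) (hM : 0 ≤ M) (hl : 1 < l) (hT : 0 < T) (hTS : T ≤ S')
    (hC0 : 0 < C)
    (hC : ∀ w : ℂ, 0 < w.re → w.re ≤ S' → w.re * ‖deriv G w‖ ≤ C)
    (hwin : ∀ b : ℝ, 0 < b → b ≤ T →
      m * (∫ x in b / l..b, 1 / x * verticalMean G p x) ≤ Real.exp (2 * b + 2 * (D * ‖p‖)) *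
        (4 * ∫ x in b / l..b, x * verticalEnergy G p x) ∧
      4 * (∫ x in b / l..b, x * verticalEnergy G p x) ≤ Real.exp (2 * b + 2 * (D * ‖p‖)) *
        (M * ∫ x in b / l..b, 1 / x * verticalMean G p x))
    (hp : C * ‖p‖ < 1) {κ x₁ x₂ : ℝ} (hκ : κ = Real.exp (2 * T + 2 * (D * ‖p‖)))
    (hx₁ : x₁ = ‖p‖ ^ 2 / 4 * (κ⁻¹ * m * Real.log l / (1 + C * ‖p‖)))
    (hx₂ : x₂ = ‖p‖ ^ 2 / 4 * (κ * M * Real.log l / (1 - C * ‖p‖))) (hx₂' : x₂ < 1) :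
    ∃ c : ℝ, ∀ s, 0 < s → s ≤ T →
      x₁ / (1 + x₁) / Real.log l * Real.log (1 / s) - c ≤ Real.log (verticalMean G p s) ∧
      Real.log (verticalMean G p s) ≤ x₂ / (1 - x₂) / Real.log l * Real.log (1 / s) + c := by
  set K := legendreMean G p with hK
  have hε0 : 0 < 1 - C * ‖p‖ := by linarith
  have hε1 : 0 < 1 + C * ‖p‖ := by positivity
  have hlog : 0 < Real.log l := Real.log_pos hl
  have hκ0 : 0 < κ := hκ ▸ Real.exp_pos _
  have hl0 : 0 < l := by linarith
  have hx₁0 : 0 ≤ x₁ := by rw [hx₁]; positivity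
  have hx₂0 : 0 ≤ x₂ := by rw [hx₂]; positivity
  have hb := fun s (hs : 0 < s) (hsT : s ≤ T) =>
    legendreMean_bounds (p := p) hG hC hs (hsT.trans hTS)
  have hI := fun s (hs : 0 < s) => verticalMean_pos (p := p) hG hs
  have hpos : ∀ s, 0 < s → s ≤ T → 0 < K s := fun s hs hsT =>
    (mul_pos hε0 (hI s hs)).trans_le (hb s hs hsT).1
  have hanti : AntitoneOn K (Ioi 0) := antitoneOn_legendreMean hG hper
  have hstep : ∀ b, 0 < b → b ≤ T → (1 + x₁) * K b ≤ K (b / l) ∧ (1 - x₂) * K (b / l) ≤ K b := by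
    intro b hb0 hbT
    have ha : 0 < b / l := by positivity
    have hab : b / l ≤ b := div_le_self hb0.le hl.le
    have hsub : K (b / l) - K b = _ := legendreMean_sub (p := p) hG hper ha hab
    obtain ⟨h1, h2⟩ := hwin b hb0 hbT
    -- On the window K lies between K(b) and K(b/l). Comparing K with I turns these into constant
    -- bounds for I.
    have hmean := integral_mean_div_bounds (p := p) hG ha hab (u := K b / (1 + C * ‖p‖))
      (v := K (b / l) / (1 - C * ‖p‖))
      (fun x hx => by
        have hx0 := ha.trans_le hx.1
        rw [div_le_iff₀ hε1]
        have h3 := (hb x hx0 (hx.2.trans hbT)).2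
        have h4 : K b ≤ K x := hanti hx0 hb0 hx.2
        linarith)
      (fun x hx => by
        have hx0 := ha.trans_le hx.1
        rw [le_div_iff₀ hε0]
        have h3 := (hb x hx0 (hx.2.trans hbT)).1
        have h4 : K x ≤ K (b / l) := hanti ha hx0 hx.1
        linarith)
    have hbl : b / (b / l) = l := by field_simp
    rw [hbl] at hmean
    set X := ∫ x in b / l..b, 1 / x * verticalMean G p x
    set E := ∫ x in b / l..b, x * verticalEnergy G p x
    have hKb := hpos b hb0 hbT
    have hKa := hpos _ ha (hab.trans hbT)
    have hX : 0 ≤ X := le_trans (by positivity) hmean.1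
    have hE : 0 ≤ E := intervalIntegral.integral_nonneg hab fun x hx =>
      mul_nonneg (ha.le.trans hx.1) (verticalEnergy_nonneg x)
    have hexp : Real.exp (2 * b + 2 * (D * ‖p‖)) ≤ κ := by
      rw [hκ]; exact Real.exp_le_exp.2 (by linarith)
    constructor
    · have h3 : m * X ≤ κ * (4 * E) := h1.trans (by gcongr)
      have h4 : κ⁻¹ * (m * X) ≤ 4 * E := by
        rw [inv_mul_le_iff₀ hκ0]; exact h3
      have h5 : x₁ * K b ≤ K (b / l) - K b := by
        rw [hsub]
        calc x₁ * K b = ‖p‖ ^ 2 / 4 * (κ⁻¹ * (m * (K b / (1 + C * ‖p‖) * Real.log l))) := by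
              rw [hx₁]; ring
          _ ≤ ‖p‖ ^ 2 / 4 * (κ⁻¹ * (m * X)) := by gcongr; exact hmean.1
          _ ≤ ‖p‖ ^ 2 / 4 * (4 * E) := by gcongr
          _ = ‖p‖ ^ 2 * E := by ring
      linarith
    · have h5 : K (b / l) - K b ≤ x₂ * K (b / l) := by
        rw [hsub]
        calc ‖p‖ ^ 2 * E = ‖p‖ ^ 2 / 4 * (4 * E) := by ring
          _ ≤ ‖p‖ ^ 2 / 4 * (κ * (M * X)) := by
              refine mul_le_mul_of_nonneg_left (h2.trans ?_) (by positivity)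
              gcongr
          _ ≤ ‖p‖ ^ 2 / 4 * (κ * (M * (K (b / l) / (1 - C * ‖p‖) * Real.log l))) := by
              gcongr; exact hmean.2
          _ = x₂ * K (b / l) := by rw [hx₂]; ring
      linarith
  have hantiT : AntitoneOn K (Ioc 0 T) := hanti.mono fun x hx => hx.1
  -- This and the next bound come from 1 + t ≤ e^t at t = -x₁/(1 + x₁) and t = x₂/(1 - x₂). They
  -- turn the step factors 1 + x₁ and 1/(1 - x₂) into exponentials.
  have hy₁ : Real.exp (x₁ / (1 + x₁)) ≤ 1 + x₁ := by
    have h1 := Real.add_one_le_exp (-(x₁ / (1 + x₁)))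
    have h2 : -(x₁ / (1 + x₁)) + 1 = (1 + x₁)⁻¹ := by field_simp; ring
    rw [h2, Real.exp_neg] at h1
    exact (inv_le_inv₀ (by positivity) (Real.exp_pos _)).1 h1
  have hy₂ : (1 - x₂)⁻¹ ≤ Real.exp (x₂ / (1 - x₂)) := by
    have h1 := Real.add_one_le_exp (x₂ / (1 - x₂))
    have h3 : 1 - x₂ ≠ 0 := by linarith
    have h2 : x₂ / (1 - x₂) + 1 = (1 - x₂)⁻¹ := by field_simp; ring
    linarith
  have h1x : 0 < 1 - x₂ := by linarith
  have hlo := fun s (hs : 0 < s) (hsT : s ≤ T) => le_log_of_geometric_growth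
    (y := x₁ / (1 + x₁)) hl (by positivity) hpos hantiT (fun b hb0 hbT =>
      (mul_le_mul_of_nonneg_right hy₁ (hpos b hb0 hbT).le).trans (hstep b hb0 hbT).1) hs hsT
  have hup := fun s (hs : 0 < s) (hsT : s ≤ T) => log_le_of_geometric_growth
    (y := x₂ / (1 - x₂)) hl (by positivity) hpos hantiT (fun b hb0 hbT => by
      refine le_trans ?_ (mul_le_mul_of_nonneg_right hy₂ (hpos b hb0 hbT).le)
      rw [← div_eq_inv_mul, le_div_iff₀ h1x]
      linarith [(hstep b hb0 hbT).2]) hs hsT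
  set y₁ := x₁ / (1 + x₁)
  set y₂ := x₂ / (1 - x₂)
  -- The constant collects every term independent of s: the value at T, the passage between K and I,
  -- rounding, and log T.
  refine ⟨|Real.log (K T)| + |Real.log (1 + C * ‖p‖)| + |Real.log (1 - C * ‖p‖)| + |y₁| + |y₂| +
    |y₁ / Real.log l * Real.log T| + |y₂ / Real.log l * Real.log T|, fun s hs hsT => ?_⟩
  have h1 := hlo s hs hsT
  have h2 := hup s hs hsT
  have hKs := hpos s hs hsT
  have hIs := hI s hs
  have h3 := Real.log_le_log hKs (hb s hs hsT).2
  have h4 := Real.log_le_log (mul_pos hε0 hIs) (hb s hs hsT).1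
  rw [Real.log_mul hε1.ne' hIs.ne'] at h3
  rw [Real.log_mul hε0.ne' hIs.ne'] at h4
  have h5 : Real.log (T / s) = Real.log T + Real.log (1 / s) := by
    rw [Real.log_div hT.ne' hs.ne', Real.log_div one_ne_zero hs.ne', Real.log_one]; ring
  rw [h5] at h1 h2
  have e : ∀ y : ℝ, ∀ z : ℝ, y * ((Real.log T + Real.log (1 / s)) / Real.log l + z) =
      y / Real.log l * Real.log T + y / Real.log l * Real.log (1 / s) + y * z := by
    intro y z; ring
  rw [sub_eq_add_neg (_ / _), e] at h1
  rw [e] at h2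
  have a1 := abs_le.1 (le_refl |Real.log (K T)|)
  have a2 := abs_le.1 (le_refl |Real.log (1 + C * ‖p‖)|)
  have a3 := abs_le.1 (le_refl |Real.log (1 - C * ‖p‖)|)
  have a4 := abs_le.1 (le_refl |y₁|)
  have a5 := abs_le.1 (le_refl |y₂|)
  have a6 := abs_le.1 (le_refl |y₁ / Real.log l * Real.log T|)
  have a7 := abs_le.1 (le_refl |y₂ / Real.log l * Real.log T|)
  constructor <;> linarith [a1.1, a1.2, a2.1, a2.2, a3.1, a3.2, a4.1, a4.2, a5.1, a5.2, a6.1,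
    a6.2, a7.1, a7.2]

end Convexity

/-! ### From growth bounds to the spectrum near p = 0. -/

theorem integralMean_eq_verticalMean (φ : ℂ → ℂ) (p : ℂ) {r : ℝ} (hr : 0 < r) :
    integralMean φ p r =
      verticalMean (fun w => logDerivBranch φ (Complex.exp w)) p (Real.log r) := by
  simp only [integralMean, verticalMean, Complex.exp_add, ← Complex.ofReal_exp, Real.exp_log hr]

theorem tendsto_log_one_div_sub_one :
    Tendsto (fun r : ℝ => Real.log (1 / (r - 1))) (𝓝[>] 1) atTop := by
  have h1 : Tendsto (fun r : ℝ => r - 1) (𝓝[>] 1) (𝓝[>] 0) := by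
    refine tendsto_nhdsWithin_iff.2 ⟨?_, ?_⟩
    · have : Tendsto (fun r : ℝ => r - 1) (𝓝 1) (𝓝 (1 - 1)) := tendsto_id.sub_const 1
      rw [sub_self] at this
      exact this.mono_left nhdsWithin_le_nhds
    · filter_upwards [self_mem_nhdsWithin] with r hr
      exact sub_pos.2 (mem_Ioi.1 hr)
  simp only [one_div]
  exact Real.tendsto_log_atTop.comp (tendsto_inv_nhdsGT_zero.comp h1)

/-- Logarithmic growth bounds determine bounds on the integral means spectrum. -/
theorem integralMeansSpectrum_bounds {φ : ℂ → ℂ} {p : ℂ} {Y₁ Y₂ T c : ℝ} (hT : 0 < T)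
    (hY₁ : 0 ≤ Y₁) (hY₂ : 0 ≤ Y₂)
    (h : ∀ s, 0 < s → s ≤ T →
      Y₁ * Real.log (1 / s) - c ≤
        Real.log (verticalMean (fun w => logDerivBranch φ (Complex.exp w)) p s) ∧
      Real.log (verticalMean (fun w => logDerivBranch φ (Complex.exp w)) p s) ≤
        Y₂ * Real.log (1 / s) + c) :
    (Y₁ : EReal) ≤ integralMeansSpectrum φ p ∧ integralMeansSpectrum φ p ≤ (Y₂ : EReal) := by
  have hev : ∀ᶠ r : ℝ in 𝓝[>] 1,
      Y₁ - c / Real.log (1 / (r - 1)) ≤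
        Real.log (integralMean φ p r) / Real.log (1 / (r - 1)) ∧
      Real.log (integralMean φ p r) / Real.log (1 / (r - 1)) ≤
        Y₂ + (Y₂ * Real.log 2 + c) / Real.log (1 / (r - 1)) := by
    -- For r < 2, log r ≤ r - 1 ≤ 2 log r. So log(1/log r) and log(1/(r - 1)) differ by at most log
    -- 2, which disappears after division.
    have hm : Ioo 1 (min (Real.exp T) 2) ∈ 𝓝[>] (1 : ℝ) :=
      Ioo_mem_nhdsGT (lt_min (Real.one_lt_exp_iff.2 hT) one_lt_two)
    filter_upwards [hm, tendsto_log_one_div_sub_one.eventually_gt_atTop 0] with r hr hΛ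
    obtain ⟨hr1, hr2⟩ := hr
    have hr0 : 0 < r := by linarith
    have hs : 0 < Real.log r := Real.log_pos hr1
    have hsT : Real.log r ≤ T := by
      rw [Real.log_le_iff_le_exp hr0]; exact (hr2.trans_le (min_le_left _ _)).le
    have hs2 : Real.log r ≤ Real.log 2 :=
      Real.log_le_log hr0 (hr2.trans_le (min_le_right _ _)).le
    have h1 : Real.log r ≤ r - 1 := Real.log_le_sub_one_of_pos hr0
    have h2 : r - 1 ≤ 2 * Real.log r := by
      have := exp_sub_one_le_two_mul hs.le hs2
      rwa [Real.exp_log hr0] at this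
    have hr1' : 0 < r - 1 := by linarith
    have h3 : Real.log (1 / (r - 1)) ≤ Real.log (1 / Real.log r) := by gcongr
    have h4 : Real.log (1 / Real.log r) ≤ Real.log (1 / (r - 1)) + Real.log 2 := by
      rw [← Real.log_mul (by positivity) two_ne_zero]
      gcongr
      rw [div_mul_eq_mul_div, div_le_div_iff₀ hs hr1']
      linarith
    obtain ⟨h5, h6⟩ := h _ hs hsT
    rw [integralMean_eq_verticalMean φ p hr0, le_div_iff₀ hΛ, div_le_iff₀ hΛ, sub_mul, add_mul,
      div_mul_cancel₀ _ hΛ.ne', div_mul_cancel₀ _ hΛ.ne']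
    constructor
    · have := mul_le_mul_of_nonneg_left h3 hY₁
      linarith
    · have := mul_le_mul_of_nonneg_left h4 hY₂
      linarith
  have hlim : ∀ Y z : ℝ,
      Tendsto (fun r : ℝ => Y + z / Real.log (1 / (r - 1))) (𝓝[>] 1) (𝓝 Y) := by
    intro Y z
    simpa using (tendsto_log_one_div_sub_one.const_div_atTop z).const_add Y
  constructor
  · have h1 : Tendsto (fun r : ℝ => ((Y₁ - c / Real.log (1 / (r - 1)) : ℝ) : EReal)) (𝓝[>] 1)
        (𝓝 (Y₁ : EReal)) := by
      refine (continuous_coe_real_ereal.tendsto Y₁).comp ((hlim Y₁ (-c)).congr fun r => ?_)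
      ring
    rw [← h1.limsup_eq]
    exact limsup_le_limsup (hev.mono fun r hr => EReal.coe_le_coe_iff.2 hr.1)
  · have h1 : Tendsto (fun r : ℝ =>
        ((Y₂ + (Y₂ * Real.log 2 + c) / Real.log (1 / (r - 1)) : ℝ) : EReal)) (𝓝[>] 1)
        (𝓝 (Y₂ : EReal)) :=
      (continuous_coe_real_ereal.tendsto Y₂).comp (hlim Y₂ _)
    rw [← h1.limsup_eq]
    exact limsup_le_limsup (hev.mono fun r hr => EReal.coe_le_coe_iff.2 hr.2)

/-- Asymptotic bounds for the integral means spectrum near the origin. -/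
theorem exists_eventually_spectrum_bounds {φ : ℂ → ℂ}
    (hg : IsLogDerivBranch φ (logDerivBranch φ)) {m M : ℝ}
    (hbox : ForAllLargeBoxes fun B =>
      m ≤ B.average (fun z => ‖2 * nonlinearity φ z / (hypDensity z : ℂ)‖ ^ 2) ∧
        B.average (fun z => ‖2 * nonlinearity φ z / (hypDensity z : ℂ)‖ ^ 2) ≤ M) :
    ∃ T₀ : ℝ, 0 < T₀ ∧ ∀ T : ℝ, 0 < T → T ≤ T₀ → ∃ f₁ f₂ : ℂ → ℝ,
      Tendsto f₁ (𝓝[≠] 0) (𝓝 ((Real.exp (2 * T))⁻¹ * max m 0)) ∧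
      Tendsto f₂ (𝓝[≠] 0) (𝓝 (Real.exp (2 * T) * M)) ∧
      ∀ᶠ p : ℂ in 𝓝[≠] 0,
        (f₁ p : EReal) ≤ integralMeansSpectrum φ p / ((‖p‖ ^ 2 / 4 : ℝ) : EReal) ∧
        integralMeansSpectrum φ p / ((‖p‖ ^ 2 / 4 : ℝ) : EReal) ≤ (f₂ p : EReal) := by
  obtain ⟨hM, l, β, S, hl, hβ, hS, hrect⟩ := exists_rectBounds hg hbox
  set G : ℂ → ℂ := fun w => logDerivBranch φ (Complex.exp w) with hGdef
  have hG : DifferentiableOn ℂ G rightHalfPlane := differentiableOn_comp_exp hg.1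
  have hper : ∀ w ∈ rightHalfPlane, G (w + 2 * Real.pi * Complex.I) = G w := fun w _ => by
    simp only [hGdef, Complex.exp_periodic w]
  obtain ⟨C, S', hC0, hS', hC⟩ := hrect.exists_bloch hG hl hβ hS
  have hm0 : 0 ≤ max m 0 := le_max_right _ _
  obtain ⟨D, T₁, hD, hT₁, hann⟩ := hrect.exists_annulus hG hm0 hM (by linarith) (by linarith) hS
    hC0 hS' hC
  have hlog : 0 < Real.log l := Real.log_pos (by linarith)
  refine ⟨min T₁ S', lt_min hT₁ hS', fun T hT hTT => ?_⟩
  let κ : ℂ → ℝ := fun p => Real.exp (2 * T + 2 * (D * ‖p‖))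
  let A₁ : ℂ → ℝ := fun p => (κ p)⁻¹ * max m 0 * Real.log l / (1 + C * ‖p‖)
  let A₂ : ℂ → ℝ := fun p => κ p * M * Real.log l / (1 - C * ‖p‖)
  have hκc : ContinuousAt κ 0 := by
    have : Continuous κ := by fun_prop
    exact this.continuousAt
  have hA₁c : ContinuousAt A₁ 0 := by
    refine (((hκc.inv₀ (Real.exp_ne_zero _)).mul continuousAt_const).mul continuousAt_const).div
      (by fun_prop) (by simp)
  have hA₂c : ContinuousAt A₂ 0 :=
    ((hκc.mul continuousAt_const).mul continuousAt_const).div (by fun_prop) (by simp)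
  have hu : ContinuousAt (fun p : ℂ => ‖p‖ ^ 2 / 4) 0 := by fun_prop
  -- `f₁` and `f₂` are the growth exponents divided by |p|²/4, with that factor cancelled so that
  -- they are continuous at p = 0. There log l cancels too, leaving the stated limits.
  let f₁ : ℂ → ℝ := fun p => A₁ p / (1 + ‖p‖ ^ 2 / 4 * A₁ p) / Real.log l
  let f₂ : ℂ → ℝ := fun p => A₂ p / (1 - ‖p‖ ^ 2 / 4 * A₂ p) / Real.log l
  have hf₁c : ContinuousAt f₁ 0 :=
    (hA₁c.div (continuousAt_const.add (hu.mul hA₁c)) (by simp)).div_const _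
  have hf₂c : ContinuousAt f₂ 0 :=
    (hA₂c.div (continuousAt_const.sub (hu.mul hA₂c)) (by simp)).div_const _
  refine ⟨f₁, f₂, ?_, ?_, ?_⟩
  · have h := hf₁c.tendsto
    have e : f₁ 0 = (Real.exp (2 * T))⁻¹ * max m 0 := by
      simp only [f₁, A₁, κ, norm_zero]
      field_simp
      norm_num
      ring
    rw [e] at h
    exact h.mono_left nhdsWithin_le_nhds
  · have h := hf₂c.tendsto
    have e : f₂ 0 = Real.exp (2 * T) * M := by
      simp only [f₂, A₂, κ, norm_zero]
      field_simp
      norm_num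
      ring
    rw [e] at h
    exact h.mono_left nhdsWithin_le_nhds
  · have he1 : ∀ᶠ p : ℂ in 𝓝[≠] 0, C * ‖p‖ < 1 := by
      refine nhdsWithin_le_nhds (ContinuousAt.eventually_lt (by fun_prop) continuousAt_const ?_)
      simp
    have he2 : ∀ᶠ p : ℂ in 𝓝[≠] 0, ‖p‖ ^ 2 / 4 * A₂ p < 1 := by
      refine nhdsWithin_le_nhds (ContinuousAt.eventually_lt (hu.mul hA₂c) continuousAt_const ?_)
      simp
    filter_upwards [he1, he2, self_mem_nhdsWithin] with p hp1 hp2 hp0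
    have hnorm : 0 < ‖p‖ := norm_pos_iff.2 hp0
    have hpos : 0 < ‖p‖ ^ 2 / 4 := by positivity
    obtain ⟨c, hc⟩ := exists_growth_bounds (p := p) hG hper hm0 hM (by linarith : 1 < l) hT
      (hTT.trans (min_le_right _ _)) hC0 hC
      (fun b hb hbT => hann p b hb (hbT.trans (hTT.trans (min_le_left _ _)))) hp1
      (κ := κ p) (x₁ := ‖p‖ ^ 2 / 4 * A₁ p) (x₂ := ‖p‖ ^ 2 / 4 * A₂ p) rfl rfl rfl hp2
    have hε0 : 0 < 1 - C * ‖p‖ := by linarith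
    have hκ0 : 0 < κ p := Real.exp_pos _
    have hA₁0 : 0 ≤ A₁ p := by
      simp only [A₁]
      positivity
    have hA₂0 : 0 ≤ A₂ p := by
      simp only [A₂]
      positivity
    have hden : 0 < 1 - ‖p‖ ^ 2 / 4 * A₂ p := by linarith
    obtain ⟨h1, h2⟩ := integralMeansSpectrum_bounds hT (by positivity) (by positivity) hc
    have hq : (0 : EReal) ≤ ((‖p‖ ^ 2 / 4 : ℝ) : EReal) := EReal.coe_nonneg.2 hpos.le
    have e1 : f₁ p = ‖p‖ ^ 2 / 4 * A₁ p / (1 + ‖p‖ ^ 2 / 4 * A₁ p) / Real.log l /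
        (‖p‖ ^ 2 / 4) := by
      simp only [f₁]; field_simp
    have e2 : f₂ p = ‖p‖ ^ 2 / 4 * A₂ p / (1 - ‖p‖ ^ 2 / 4 * A₂ p) / Real.log l /
        (‖p‖ ^ 2 / 4) := by
      simp only [f₂]; field_simp
    rw [e1, e2, EReal.coe_div _ (‖p‖ ^ 2 / 4), EReal.coe_div _ (‖p‖ ^ 2 / 4)]
    exact ⟨EReal.div_le_div_right_of_nonneg hq h1, EReal.div_le_div_right_of_nonneg hq h2⟩

theorem theorem1p6 (k : ℝ) (hk₀ : 0 ≤ k) (hk₁ : k < 1) (φ : ℂ → ℂ) (hφ : IsSigma k φ) (m M : ℝ)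
    (hbox : ForAllLargeBoxes fun B =>
      m ≤ B.average (fun z => ‖2 * nonlinearity φ z / (hypDensity z : ℂ)‖ ^ 2) ∧
        B.average (fun z => ‖2 * nonlinearity φ z / (hypDensity z : ℂ)‖ ^ 2) ≤ M) :
    (m : EReal) ≤
        liminf (fun p : ℂ => integralMeansSpectrum φ p / ((‖p‖ ^ 2 / 4 : ℝ) : EReal)) (𝓝[≠] 0) ∧
      liminf (fun p : ℂ => integralMeansSpectrum φ p / ((‖p‖ ^ 2 / 4 : ℝ) : EReal)) (𝓝[≠] 0) ≤
        limsup (fun p : ℂ => integralMeansSpectrum φ p / ((‖p‖ ^ 2 / 4 : ℝ) : EReal)) (𝓝[≠] 0) ∧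
      limsup (fun p : ℂ => integralMeansSpectrum φ p / ((‖p‖ ^ 2 / 4 : ℝ) : EReal)) (𝓝[≠] 0) ≤
        (M : EReal) := by
  obtain ⟨T₀, hT₀, h⟩ := exists_eventually_spectrum_bounds hφ.isLogDerivBranch hbox
  have hT : ∀ᶠ T : ℝ in 𝓝[>] 0, 0 < T ∧ T ≤ T₀ := by
    -- The order of limits matters: p → 0 with T fixed gives bounds with e^{±2T}, and only then does
    -- T → 0.
    filter_upwards [Ioc_mem_nhdsGT hT₀] with T hT using hT
  refine ⟨?_, liminf_le_limsup, ?_⟩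
  · refine le_trans (EReal.coe_le_coe_iff.2 (le_max_left m 0)) ?_
    have hlim : Tendsto (fun T : ℝ => (((Real.exp (2 * T))⁻¹ * max m 0 : ℝ) : EReal)) (𝓝[>] 0)
        (𝓝 ((max m 0 : ℝ) : EReal)) := by
      refine (continuous_coe_real_ereal.tendsto _).comp ?_
      have : ContinuousAt (fun T : ℝ => (Real.exp (2 * T))⁻¹ * max m 0) 0 := by
        refine ContinuousAt.mul (ContinuousAt.inv₀ (by fun_prop) (Real.exp_ne_zero _))
          continuousAt_const
      simpa using this.tendsto.mono_left (nhdsWithin_le_nhds (s := Ioi 0))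
    refine le_of_tendsto hlim ?_
    filter_upwards [hT] with T hT
    obtain ⟨f₁, f₂, hf₁, -, hf⟩ := h T hT.1 hT.2
    rw [← ((continuous_coe_real_ereal.tendsto _).comp hf₁).liminf_eq]
    exact liminf_le_liminf (hf.mono fun p hp => hp.1)
  · have hlim : Tendsto (fun T : ℝ => ((Real.exp (2 * T) * M : ℝ) : EReal)) (𝓝[>] 0)
        (𝓝 (M : EReal)) := by
      refine (continuous_coe_real_ereal.tendsto _).comp ?_
      have : ContinuousAt (fun T : ℝ => Real.exp (2 * T) * M) 0 := by fun_prop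
      simpa using this.tendsto.mono_left (nhdsWithin_le_nhds (s := Ioi 0))
    refine ge_of_tendsto hlim ?_
    filter_upwards [hT] with T hT
    obtain ⟨f₁, f₂, -, hf₂, hf⟩ := h T hT.1 hT.2
    rw [← ((continuous_coe_real_ereal.tendsto _).comp hf₂).limsup_eq]
    exact limsup_le_limsup (hf.mono fun p hp => hp.2)
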